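/- Fix $n\ge 1$ and work over $\mathbf{C}$; $\mathrm{Vec}$ is the category of finite dimensional vector spaces. Let $\mathrm{Flag}_n$ be the category of finite dimensional vector spaces $V$ with a flag $0=V_0\subseteq V_1\subseteq\cdots\subseteq V_n=V$; morphisms are the linear maps $f$ with $f(V_i)\subseteq W_i$ for all $i$. Let $\mathscr{A}$ be the category of polynomial functors $\mathrm{Flag}_n\to\mathrm{Vec}$, i.e. of subquotients of finite direct sums of the functors $\{V_i\}\mapsto V^{\otimes a}$ ($a\ge 0$), with the pointwise tensor product. Let $\mathbf{V}$ be the vector space with basis $e_{i,m}$ ($1\le i\le n$, $m\ge 1$), let $\mathbf{V}_i$ be the span of the $e_{k,m}$ with $k\le i$, and let $\mathbf{G}$ be the group of automorphisms of $\mathbf{V}$ that preserve this flag and that, for some $j$, preserve the span of the $e_{i,m}$ with $m\le j$ and fix all other basis vectors. Let $\mathrm{Rep}(\mathbf{G})$ be the category of polynomial representations of $\mathbf{G}$, i.e. of subquotients of finite direct sums of tensor powers of $\mathbf{V}$, with the usual tensor product. Both categories are tensor categories ($\mathbf{C}$-linear and symmetric monoidal). For $\underline{a}\in\mathbf{N}^n$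 let $\mathbf{C}^{\underline{a}}\subset\mathbf{V}$ be the span of the $e_{i,m}$ with $m\le a_i$, with the induced flag, and let $H_{\underline{a}}\subset\mathbf{G}$ be the subgroup of the block diagonal matrices whose $(i,i)$ block is of the form $\begin{pmatrix}1&0\\0&*\end{pmatrix}$ with top left block of size $a_i\times a_i$. On a polynomial representation $V$ the action of $\mathbf{G}$ extends uniquely to an action, polynomial in the matrix entries, of the monoid of those flag preserving endomorphisms of $\mathbf{V}$ that, for some $j$, preserve the span of the $e_{i,m}$ with $m\le j$ and fix all other basis vectors. For a morphism $f:\mathbf{C}^{\underline{a}}\to\mathbf{C}^{\underline{b}}$ in $\mathrm{Flag}_n$, any element $g_f$ of this monoid that extends $f$ maps $V^{H_{\underline{a}}}$ to $V^{H_{\underline{b}}}$, and the resulting map does not depend on the choice of $g_f$. So $\underline{a}\mapsto V^{H_{\underline{a}}}$ is a functor on the full subcategory of $\mathrm{Flag}_n$ on the flags $\mathbf{C}^{\underline{a}}$. **Proposition.** (1) For $F\in\mathscr{A}$ the direct limit $\Phi(F)=\varinjlim_j F(\mathbf{C}^{(j^n)})$, where $(j^n)=(j,\dots,j)$, with its natural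 action of $\mathbf{G}$, is a polynomial representation; this defines a functor $\Phi:\mathscr{A}\to\mathrm{Rep}(\mathbf{G})$. (2) There is a functor $\Psi:\mathrm{Rep}(\mathbf{G})\to\mathscr{A}$ with $\Psi(V)(\mathbf{C}^{\underline{a}})=V^{H_{\underline{a}}}$, naturally in $V$ and in $\mathbf{C}^{\underline{a}}$ (with the functoriality in $\mathbf{C}^{\underline{a}}$ just described). (3) $\Phi$ and $\Psi$ are $\mathbf{C}$-linear symmetric monoidal functors, with the canonical structures: those induced by $(x,y)\mapsto x\otimes y$ on $F(\mathbf{C}^{(j^n)})\times F'(\mathbf{C}^{(j^n)})$ and on $V^{H_{\underline{a}}}\times W^{H_{\underline{a}}}$ respectively. (4) $\Phi$ is left adjoint to $\Psi$ by a monoidal adjunction whose unit and counit are isomorphisms, and whose counit $\Phi\Psi(V)=\varinjlim_j V^{H_{(j^n)}}\to V$ is induced by the inclusions $V^{H_{(j^n)}}\subseteq V$. In particular $\Phi$ and $\Psi$ are mutually inverse equivalences of tensor categories $\mathscr{A}\cong\mathrm{Rep}(\mathbf{G})$. -/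

import Mathlib

open CategoryTheory MonoidalCategory

namespace FlagSchur

noncomputable section

/-! ### Tensor powers, subquotients and polynomial objects in a monoidal category -/

section General

open CategoryTheory.Limits

universe v u

variable {C : Type u} [Category.{v} C] [MonoidalCategory C]

/-- The tensor power `T ⊗ ⋯ ⊗ T` with `k` factors. -/
def tensorPow (T : C) : ℕ → C
  | 0 => 𝟙_ C
  | k + 1 => tensorPow T k ⊗ T

/-- `X` is a subquotient of `Y`: a quotient of a subobject of `Y`. -/
def IsSubquotient (X Y : C) : Prop :=
  ∃ (Z : C) (i : Z ⟶ Y) (q : Z ⟶ X), Mono i ∧ Epi q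

/-- The canonical isomorphism `T^{⊗a} ⊗ T^{⊗b} ≅ T^{⊗(a+b)}`. -/
def tensorPowAdd (T : C) (a : ℕ) :
    (b : ℕ) → (tensorPow T a ⊗ tensorPow T b ≅ tensorPow T (a + b))
  | 0 => ρ_ _
  | b + 1 => (α_ _ _ _).symm ≪≫ whiskerRightIso (tensorPowAdd T a b) T

variable [Preadditive C] [HasFiniteBiproducts C]

/-- The objects that are subquotients of a finite direct sum of tensor powers of `T`. -/
def isPolynomial (T : C) : ObjectProperty C := fun X =>
  ∃ (k : ℕ) (a : Fin k → ℕ), IsSubquotient X (⨁ fun i => tensorPow T (a i))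

/-- If tensoring is exact, then the polynomial objects contain the unit and are closed under the
tensor product. -/
theorem isPolynomial_isMonoidal [MonoidalPreadditive C]
    (hm : ∀ (X : C) {Y Z : C} (f : Y ⟶ Z), Mono f → Mono (X ◁ f))
    (hm' : ∀ (X : C) {Y Z : C} (f : Y ⟶ Z), Mono f → Mono (f ▷ X))
    (he : ∀ (X : C) {Y Z : C} (f : Y ⟶ Z), Epi f → Epi (X ◁ f))
    (he' : ∀ (X : C) {Y Z : C} (f : Y ⟶ Z), Epi f → Epi (f ▷ X)) (T : C) :
    (isPolynomial T).IsMonoidal where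
  prop_unit := by
    refine ⟨1, fun _ => 0, 𝟙_ C, biproduct.ι (fun _ : Fin 1 => tensorPow T 0) 0, 𝟙 _, ?_, ?_⟩
    · have : IsSplitMono (biproduct.ι (fun _ : Fin 1 => tensorPow T 0) 0) := inferInstance
      exact inferInstanceAs (Mono (biproduct.ι (fun _ : Fin 1 => tensorPow T 0) 0))
    · infer_instance
  prop_tensor := by
    rintro X Y ⟨k, a, Z, i, q, hi, hq⟩ ⟨l, b, W, j, r, hj, hr⟩
    have e1 : (⨁ fun i => tensorPow T (a i)) ⊗ (⨁ fun i => tensorPow T (b i)) ≅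
        ⨁ fun s : Fin (k * l) =>
          tensorPow T (a (finProdFinEquiv.symm s).1 + b (finProdFinEquiv.symm s).2) :=
      rightDistributor _ _ ≪≫ biproduct.mapIso (fun x => leftDistributor _ _) ≪≫
      (biproductBiproductIso (fun _ : Fin k => Fin l)
        (fun x y => tensorPow T (a x) ⊗ tensorPow T (b y))) ≪≫
      biproduct.whiskerEquiv ((Equiv.sigmaEquivProd (Fin k) (Fin l)).trans finProdFinEquiv)
        (fun s => (tensorPowAdd T _ _).symm ≪≫ eqToIso (by simp))
    refine ⟨k * l, _, Z ⊗ W, (i ⊗ₘ j) ≫ e1.hom, q ⊗ₘ r, ?_, ?_⟩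
    · rw [MonoidalCategory.tensorHom_def]
      have := hm' W i hi
      have := hm (⨁ fun i => tensorPow T (a i)) j hj
      infer_instance
    · rw [MonoidalCategory.tensorHom_def]
      have := he' W q hq
      have := he X r hr
      infer_instance

end General

/-! ### Flags of vector spaces -/

/-- A finite dimensional complex vector space `V` with a flag
`0 = V₀ ⊆ V₁ ⊆ ⋯ ⊆ Vₙ = V` of length `n`. -/
structure FlagCat (n : ℕ) where
  carrier : Type
  [addCommGroup : AddCommGroup carrier]
  [module : Module ℂ carrier]
  [finite : Module.Finite ℂ carrier]
  fil : Fin (n + 1) → Submodule ℂ carrier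
  mono : Monotone fil
  fil_zero : fil 0 = ⊥
  fil_last : fil (Fin.last n) = ⊤

attribute [instance] FlagCat.addCommGroup FlagCat.module FlagCat.finite

/-- A morphism of flags: a linear map with `f(Vᵢ) ⊆ Wᵢ` for all `i`. -/
@[ext]
structure FlagCat.Hom {n : ℕ} (V W : FlagCat n) where
  toLin : V.carrier →ₗ[ℂ] W.carrier
  map_fil : ∀ i, ∀ x ∈ V.fil i, toLin x ∈ W.fil i

instance (n : ℕ) : Category (FlagCat n) where
  Hom V W := FlagCat.Hom V W
  id V := ⟨LinearMap.id, fun _ _ h => h⟩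
  comp f g := ⟨g.toLin ∘ₗ f.toLin, fun i x h => g.map_fil i _ (f.map_fil i x h)⟩

/-- The functor that forgets the flag. -/
def flagForget (n : ℕ) : FlagCat n ⥤ FGModuleCat ℂ where
  obj V := FGModuleCat.of ℂ V.carrier
  map f := FGModuleCat.ofHom f.toLin

/-- The category of all functors from flags to finite dimensional vector spaces, with the
pointwise tensor product. -/
abbrev FlagFunctor (n : ℕ) := FlagCat n ⥤ FGModuleCat ℂ

instance (n : ℕ) : Limits.HasFiniteBiproducts (FlagFunctor n) :=
  Abelian.hasFiniteBiproducts

instance (n : ℕ) : MonoidalPreadditive (FlagFunctor n) where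

/-- Polynomial functors: the subquotients of finite direct sums of the functors
`{Vᵢ} ↦ V^{⊗a}`. -/
def isPolyFunctor (n : ℕ) : ObjectProperty (FlagFunctor n) :=
  isPolynomial (flagForget n)

theorem fg_mono_iff {X Y : FGModuleCat ℂ} (f : X ⟶ Y) :
    Mono f ↔ Function.Injective f.hom.hom :=
  ⟨fun _ => (ModuleCat.mono_iff_injective ((forget₂ _ (ModuleCat ℂ)).map f)).1 inferInstance,
    fun h => (forget₂ _ (ModuleCat ℂ)).mono_of_mono_map
      ((ModuleCat.mono_iff_injective ((forget₂ _ (ModuleCat ℂ)).map f)).2 h)⟩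

theorem fg_epi_iff {X Y : FGModuleCat ℂ} (f : X ⟶ Y) :
    Epi f ↔ Function.Surjective f.hom.hom :=
  ⟨fun _ => (ModuleCat.epi_iff_surjective ((forget₂ _ (ModuleCat ℂ)).map f)).1 inferInstance,
    fun h => (forget₂ _ (ModuleCat ℂ)).epi_of_epi_map
      ((ModuleCat.epi_iff_surjective ((forget₂ _ (ModuleCat ℂ)).map f)).2 h)⟩

instance (n : ℕ) : (isPolyFunctor n).IsMonoidal := by
  apply isPolynomial_isMonoidal
  · intro X Y Z f hf
    rw [NatTrans.mono_iff_mono_app] at hf ⊢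
    intro c
    have h := (fg_mono_iff _).1 (hf c)
    exact (fg_mono_iff _).2 (Module.Flat.lTensor_preserves_injective_linearMap _ h)
  · intro X Y Z f hf
    rw [NatTrans.mono_iff_mono_app] at hf ⊢
    intro c
    have h := (fg_mono_iff _).1 (hf c)
    exact (fg_mono_iff _).2 (Module.Flat.rTensor_preserves_injective_linearMap _ h)
  · intro X Y Z f hf
    rw [NatTrans.epi_iff_epi_app] at hf ⊢
    intro c
    have h := (fg_epi_iff _).1 (hf c)
    exact (fg_epi_iff _).2 (LinearMap.lTensor_surjective _ h)
  · intro X Y Z f hf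
    rw [NatTrans.epi_iff_epi_app] at hf ⊢
    intro c
    have h := (fg_epi_iff _).1 (hf c)
    exact (fg_epi_iff _).2 (LinearMap.rTensor_surjective _ h)

/-- The tensor category of polynomial functors from flags of length `n` to finite dimensional
vector spaces. -/
abbrev PolyFunctor (n : ℕ) := (isPolyFunctor n).FullSubcategory

/-! ### The infinite rank group and its polynomial representations -/

/-- The standard representation, with basis `e_{i,m}` for `i` in `Fin n` and `m` in `ℕ`. -/
abbrev VInf (n : ℕ) := (Fin n × ℕ) →₀ ℂ

/-- The step `Vᵢ` of the flag on the standard representation, spanned by the basis vectors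
of the first `i` graded pieces. -/
def flagSub (n : ℕ) (i : Fin (n + 1)) : Submodule ℂ (VInf n) :=
  Finsupp.supported ℂ ℂ {p | (p.1 : ℕ) < i}

/-- The subspace `ℂ^a`, spanned by the first `aᵢ` basis vectors of the `i`-th graded piece
for all `i`. -/
def stdSub {n : ℕ} (a : Fin n → ℕ) : Submodule ℂ (VInf n) :=
  Finsupp.supported ℂ ℂ {p | p.2 < a p.1}

/-- The constant tuple `(jⁿ) = (j, …, j)`. -/
abbrev cst (n j : ℕ) : Fin n → ℕ := fun _ => j

/-- `A` lies in the `j`-th finite level: it maps `ℂ^{(jⁿ)}` to itself and fixes all other basis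
vectors. -/
def IsLevel {n : ℕ} (j : ℕ) (A : VInf n →ₗ[ℂ] VInf n) : Prop :=
  (∀ x ∈ stdSub (cst n j), A x ∈ stdSub (cst n j)) ∧
    ∀ p : Fin n × ℕ, j ≤ p.2 → A (Finsupp.single p 1) = Finsupp.single p 1

theorem stdSub_mono {n : ℕ} {a b : Fin n → ℕ} (h : a ≤ b) : stdSub a ≤ stdSub b :=
  Finsupp.supported_mono fun p (hp : p.2 < a p.1) => lt_of_lt_of_le hp (h p.1)

theorem single_mem_stdSub {n : ℕ} {a : Fin n → ℕ} {p : Fin n × ℕ} (h : p.2 < a p.1) (c : ℂ) :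
    Finsupp.single p c ∈ stdSub a :=
  Finsupp.single_mem_supported ℂ c h

theorem stdSub_induction {n : ℕ} {a : Fin n → ℕ} {W : Submodule ℂ (VInf n)}
    (h : ∀ p : Fin n × ℕ, p.2 < a p.1 → Finsupp.single p 1 ∈ W) : stdSub a ≤ W := by
  rw [stdSub, Finsupp.supported_eq_span_single, Submodule.span_le]
  rintro _ ⟨p, hp, rfl⟩
  exact h p hp

theorem IsLevel.mono {n : ℕ} {j k : ℕ} (hjk : j ≤ k) {A : VInf n →ₗ[ℂ] VInf n}
    (h : IsLevel j A) : IsLevel k A := by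
  refine ⟨fun x hx => ?_, fun p hp => h.2 p (hjk.trans hp)⟩
  refine stdSub_induction (W := (stdSub (cst n k)).comap A) (fun p hp => ?_) hx
  rw [Submodule.mem_comap]
  by_cases hj : j ≤ p.2
  · rw [h.2 p hj]; exact single_mem_stdSub hp 1
  · exact stdSub_mono (fun _ => hjk) (h.1 _ (single_mem_stdSub (not_le.1 hj) 1))

theorem IsLevel.id {n : ℕ} (j : ℕ) : IsLevel j (LinearMap.id : VInf n →ₗ[ℂ] VInf n) :=
  ⟨fun _ h => h, fun _ _ => rfl⟩

theorem IsLevel.comp {n : ℕ} {j : ℕ} {A B : VInf n →ₗ[ℂ] VInf n} (hA : IsLevel j A)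
    (hB : IsLevel j B) : IsLevel j (A ∘ₗ B) :=
  ⟨fun x hx => hA.1 _ (hB.1 x hx), fun p hp => by
    rw [LinearMap.comp_apply, hB.2 p hp, hA.2 p hp]⟩

theorem exists_mem_stdSub {n : ℕ} (x : VInf n) : ∃ j, x ∈ stdSub (cst n j) := by
  refine ⟨x.support.sup (fun p => p.2) + 1, ?_⟩
  rw [stdSub, Finsupp.mem_supported]
  intro p hp
  exact Nat.lt_succ_of_le (Finset.le_sup (f := fun p : Fin n × ℕ => p.2) hp)

/-- `x` is the sum of its part in `ℂ^{(jⁿ)}` and of a vector supported outside. -/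
theorem split_level {n : ℕ} (j : ℕ) (x : VInf n) : ∃ y z, x = y + z ∧ y ∈ stdSub (cst n j) ∧
    z ∈ Finsupp.supported ℂ ℂ {p : Fin n × ℕ | j ≤ p.2} ∧
    (∀ i, x ∈ flagSub n i → y ∈ flagSub n i ∧ z ∈ flagSub n i) := by
  classical
  refine ⟨x.filter (fun p => p.2 < j), x.filter (fun p => ¬ p.2 < j),
    (Finsupp.filter_add_filter_not x _).symm, ?_, ?_, ?_⟩
  · rw [stdSub, Finsupp.mem_supported]
    intro p hp
    rw [Finsupp.support_filter, Finset.mem_coe, Finset.mem_filter] at hp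
    exact hp.2
  · rw [Finsupp.mem_supported]
    intro p hp
    rw [Finsupp.support_filter, Finset.mem_coe, Finset.mem_filter] at hp
    exact not_lt.1 hp.2
  · intro i hx
    rw [flagSub, Finsupp.mem_supported] at *
    rw [Finsupp.mem_supported]
    constructor
    · intro p hp
      rw [Finsupp.support_filter, Finset.mem_coe, Finset.mem_filter] at hp
      exact hx hp.1
    · intro p hp
      rw [Finsupp.support_filter, Finset.mem_coe, Finset.mem_filter] at hp
      exact hx hp.1

theorem IsLevel.fix {n : ℕ} {j : ℕ} {A : VInf n →ₗ[ℂ] VInf n} (hA : IsLevel j A) {z : VInf n}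
    (hz : z ∈ Finsupp.supported ℂ ℂ {p : Fin n × ℕ | j ≤ p.2}) : A z = z := by
  have : Finsupp.supported ℂ ℂ {p : Fin n × ℕ | j ≤ p.2} ≤ LinearMap.eqLocus A LinearMap.id := by
    rw [Finsupp.supported_eq_span_single, Submodule.span_le]
    rintro _ ⟨p, hp, rfl⟩
    exact hA.2 p hp
  exact this hz

/-- The group `𝐆`: the invertible finitary matrices (the union of the groups of invertible
matrices of the finite levels) that preserve the flag of the standard representation. -/
def G (n : ℕ) : Subgroup (VInf n ≃ₗ[ℂ] VInf n) where
  carrier := {g | (∀ i, (flagSub n i).map (g : VInf n →ₗ[ℂ] VInf n) = flagSub n i) ∧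
    ∃ j, IsLevel j (g : VInf n →ₗ[ℂ] VInf n) ∧ IsLevel j (g.symm : VInf n →ₗ[ℂ] VInf n)}
  one_mem' := ⟨fun i => Submodule.map_id _, 0, IsLevel.id 0, IsLevel.id 0⟩
  mul_mem' := by
    rintro g h ⟨hg, j, hj, hj'⟩ ⟨hh, k, hk, hk'⟩
    refine ⟨fun i => ?_, max j k, ?_, ?_⟩
    · have : ((g * h : VInf n ≃ₗ[ℂ] VInf n) : VInf n →ₗ[ℂ] VInf n) =
        (g : VInf n →ₗ[ℂ] VInf n) ∘ₗ (h : VInf n →ₗ[ℂ] VInf n) := rfl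
      rw [this, Submodule.map_comp, hh, hg]
    · exact (hj.mono (le_max_left j k)).comp (hk.mono (le_max_right j k))
    · exact (hk'.mono (le_max_right j k)).comp (hj'.mono (le_max_left j k))
  inv_mem' := by
    rintro g ⟨hg, j, hj, hj'⟩
    refine ⟨fun i => ?_, j, hj', hj⟩
    conv_lhs => rw [← hg i]
    rw [← Submodule.map_comp]
    have : ((g⁻¹ : VInf n ≃ₗ[ℂ] VInf n) : VInf n →ₗ[ℂ] VInf n) ∘ₗ
        (g : VInf n →ₗ[ℂ] VInf n) = LinearMap.id := by
      refine LinearMap.ext fun x => ?_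
      exact g.symm_apply_apply x
    rw [this, Submodule.map_id]

/-- The linear endomorphism of the standard representation underlying an element of `𝐆`. -/
def toEnd {n : ℕ} (g : G n) : VInf n →ₗ[ℂ] VInf n := ((g : VInf n ≃ₗ[ℂ] VInf n) : _ →ₗ[ℂ] _)

/-- The standard representation of `𝐆`. -/
def stdRep (n : ℕ) : Rep.{0} ℂ (G n) :=
  Rep.of (X := VInf n)
    { toFun := fun g => toEnd g
      map_one' := rfl
      map_mul' := fun _ _ => rfl }

instance (n : ℕ) : Limits.HasFiniteBiproducts (Rep.{0} ℂ (G n)) :=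
  Abelian.hasFiniteBiproducts

/-- Polynomial representations of `𝐆`: the subquotients of finite direct sums of tensor powers
of the standard representation. -/
def isPolyRep (n : ℕ) : ObjectProperty (Rep.{0} ℂ (G n)) :=
  isPolynomial (stdRep n)

instance (n : ℕ) : (isPolyRep n).IsMonoidal := by
  apply isPolynomial_isMonoidal
  · intro X Y Z f hf
    rw [Rep.mono_iff_injective] at hf ⊢
    exact Module.Flat.lTensor_preserves_injective_linearMap f.hom.toLinearMap hf
  · intro X Y Z f hf
    rw [Rep.mono_iff_injective] at hf ⊢
    exact Module.Flat.rTensor_preserves_injective_linearMap f.hom.toLinearMap hf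
  · intro X Y Z f hf
    rw [Rep.epi_iff_surjective] at hf ⊢
    exact LinearMap.lTensor_surjective X (g := f.hom.toLinearMap) hf
  · intro X Y Z f hf
    rw [Rep.epi_iff_surjective] at hf ⊢
    exact LinearMap.rTensor_surjective X (g := f.hom.toLinearMap) hf

/-- The tensor category `Rep(𝐆)` of polynomial representations of `𝐆`. -/
abbrev PolyRep (n : ℕ) := (isPolyRep n).FullSubcategory

/-! ### The direct limit functor -/

theorem finite_stdSub_index {n : ℕ} (a : Fin n → ℕ) : {p : Fin n × ℕ | p.2 < a p.1}.Finite := by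
  refine Set.Finite.subset
    ((Set.finite_univ (α := Fin n)).prod (Set.finite_Iio (Finset.univ.sup a))) ?_
  intro p hp
  have h : p.2 < a p.1 := hp
  exact ⟨Set.mem_univ _, Set.mem_Iio.2 (h.trans_le (Finset.le_sup (Finset.mem_univ p.1)))⟩

instance {n : ℕ} (a : Fin n → ℕ) : Module.Finite ℂ (stdSub a) := by
  have := (finite_stdSub_index a).to_subtype
  exact Module.Finite.equiv
    (Finsupp.supportedEquivFinsupp (M := ℂ) (R := ℂ) {p : Fin n × ℕ | p.2 < a p.1}).symm

theorem flagSub_mono (n : ℕ) : Monotone (flagSub n) := by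
  intro i j hij
  refine Finsupp.supported_mono fun p hp => ?_
  have h : (p.1 : ℕ) < (i : ℕ) := hp
  exact h.trans_le (Fin.le_def.1 hij)

/-- The flag `0 ⊆ ℂ^{a₁} ⊆ ℂ^{a₁+a₂} ⊆ ⋯ ⊆ ℂ^{|a|}`, realised inside the standard
representation. -/
def stdFlag {n : ℕ} (a : Fin n → ℕ) : FlagCat n where
  carrier := stdSub a
  fil i := (flagSub n i).comap (stdSub a).subtype
  mono i j hij := Submodule.comap_mono (flagSub_mono n hij)
  fil_zero := by
    rw [eq_bot_iff]
    intro x hx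
    have h : flagSub n 0 = ⊥ := by simp [flagSub]
    rw [Submodule.mem_comap, h, Submodule.mem_bot] at hx
    exact (Submodule.mem_bot ℂ).2 (Subtype.ext hx)
  fil_last := by
    have h : flagSub n (Fin.last n) = ⊤ := by simp [flagSub]
    rw [h, Submodule.comap_top]

/-- `A` preserves the flag of the standard representation. -/
def PreservesFlag {n : ℕ} (A : VInf n →ₗ[ℂ] VInf n) : Prop :=
  ∀ i, ∀ x ∈ flagSub n i, A x ∈ flagSub n i

theorem PreservesFlag.id {n : ℕ} : PreservesFlag (LinearMap.id : VInf n →ₗ[ℂ] VInf n) :=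
  fun _ _ h => h

theorem PreservesFlag.comp {n : ℕ} {A B : VInf n →ₗ[ℂ] VInf n} (hA : PreservesFlag A)
    (hB : PreservesFlag B) : PreservesFlag (A ∘ₗ B) :=
  fun i x h => hA i _ (hB i x h)

theorem preservesFlag_toEnd {n : ℕ} (g : G n) : PreservesFlag (toEnd g) := by
  intro i x hx
  have h := g.2.1 i
  rw [← h]
  exact Submodule.mem_map_of_mem hx

theorem exists_level {n : ℕ} (g : G n) : ∃ j, IsLevel j (toEnd g) :=
  let ⟨j, hj, _⟩ := g.2.2
  ⟨j, hj⟩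

/-- The morphism `ℂ^a ⟶ ℂ^b` of flags induced by a flag preserving endomorphism of the standard
representation that maps `ℂ^a` into `ℂ^b`. -/
def stdHom {n : ℕ} {a b : Fin n → ℕ} (A : VInf n →ₗ[ℂ] VInf n) (hA : PreservesFlag A)
    (h : ∀ x ∈ stdSub a, A x ∈ stdSub b) : stdFlag a ⟶ stdFlag b :=
  FlagCat.Hom.mk (V := stdFlag a) (W := stdFlag b) (A.restrict h) fun i x hx =>
    hA i ((stdSub a).subtype x) hx

theorem stdHom_comp {n : ℕ} {a b c : Fin n → ℕ} {A B : VInf n →ₗ[ℂ] VInf n}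
    (hA : PreservesFlag A) (hB : PreservesFlag B) (h : ∀ x ∈ stdSub a, A x ∈ stdSub b)
    (h' : ∀ x ∈ stdSub b, B x ∈ stdSub c) :
    stdHom A hA h ≫ stdHom B hB h' =
      stdHom (B ∘ₗ A) (hB.comp hA) (fun x hx => h' _ (h x hx)) := rfl

/-- The natural morphism `ℂ^a ⟶ ℂ^b` for `a ≤ b`. -/
def stdIncl {n : ℕ} {a b : Fin n → ℕ} (h : a ≤ b) : stdFlag a ⟶ stdFlag b :=
  stdHom LinearMap.id PreservesFlag.id fun _ hx => stdSub_mono h hx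

section Limit

variable {n : ℕ} (F : FlagFunctor n)

/-- The value `F(ℂ^a)`. -/
abbrev stdVal (a : Fin n → ℕ) : Type := (F.obj (stdFlag a)).obj

/-- The linear map `F(f)`. -/
abbrev mapLin {V W : FlagCat n} (f : V ⟶ W) : (F.obj V).obj →ₗ[ℂ] (F.obj W).obj :=
  (F.map f).hom.hom

theorem mapLin_comp {U V W : FlagCat n} (f : U ⟶ V) (g : V ⟶ W) (x : (F.obj U).obj) :
    mapLin F g (mapLin F f x) = mapLin F (f ≫ g) x := by
  simp [mapLin]

/-- The direct limit of the spaces `F(ℂ^{(jⁿ)})`. -/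
abbrev LimSpace : Type :=
  Module.DirectLimit (fun j : ℕ => stdVal F (cst n j))
    (fun _ _ h => mapLin F (stdIncl fun _ => h))

/-- The canonical map from `F(ℂ^{(jⁿ)})` to the direct limit. -/
abbrev limOf (j : ℕ) : stdVal F (cst n j) →ₗ[ℂ] LimSpace F :=
  Module.DirectLimit.of ℂ ℕ (fun j : ℕ => stdVal F (cst n j))
    (fun _ _ h => mapLin F (stdIncl fun _ => h)) j

theorem limOf_incl {j k : ℕ} (h : cst n j ≤ cst n k) (hjk : j ≤ k) (x : stdVal F (cst n j)) :
    limOf F k (mapLin F (stdIncl h) x) = limOf F j x :=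
  Module.DirectLimit.of_f (hij := hjk)

theorem IsLevel.maps {A : VInf n →ₗ[ℂ] VInf n} {l : ℕ} (h : IsLevel l A) {j k : ℕ} (hj : j ≤ k)
    (hl : l ≤ k) : ∀ x ∈ stdSub (cst n j), A x ∈ stdSub (cst n k) :=
  fun _ hx => (h.mono hl).1 _ (stdSub_mono (fun _ => hj) hx)

/-- The action of an element of `𝐆` on the direct limit: on `F(ℂ^{(jⁿ)})` it is given by `F`
applied to the morphism `ℂ^{(jⁿ)} ⟶ ℂ^{(kⁿ)}` that it induces for large `k`. -/
def limAct (g : G n) : LimSpace F →ₗ[ℂ] LimSpace F :=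
  Module.DirectLimit.lift ℂ ℕ _ _
    (fun j => limOf F (max j (exists_level g).choose) ∘ₗ
      mapLin F (stdHom (toEnd g) (preservesFlag_toEnd g)
        ((exists_level g).choose_spec.maps (le_max_left _ _) (le_max_right _ _))))
    (by
      intro i j hij x
      simp only [LinearMap.comp_apply]
      rw [mapLin_comp]
      rw [← limOf_incl F (j := max i (exists_level g).choose) (k := max j (exists_level g).choose)
        (fun _ => max_le_max_right _ hij) (max_le_max_right _ hij), mapLin_comp]
      rfl)

theorem limAct_of (g : G n) {j k : ℕ} (h : ∀ x ∈ stdSub (cst n j), toEnd g x ∈ stdSub (cst n k))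
    (x : stdVal F (cst n j)) :
    limAct F g (limOf F j x) =
      limOf F k (mapLin F (stdHom (toEnd g) (preservesFlag_toEnd g) h) x) := by
  rw [limAct, limOf, Module.DirectLimit.lift_of]
  simp only [LinearMap.comp_apply]
  set m := max j (exists_level g).choose
  rw [← limOf_incl F (j := m) (k := max m k) (fun _ => le_max_left _ _) (le_max_left _ _),
    ← limOf_incl F (j := k) (k := max m k) (fun _ => le_max_right _ _) (le_max_right _ _),
    mapLin_comp, mapLin_comp]
  rfl

/-- The representation of `𝐆` on the direct limit of the spaces `F(ℂ^{(jⁿ)})`. -/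
def limRep : Representation ℂ (G n) (LimSpace F) where
  toFun := limAct F
  map_one' := by
    refine LinearMap.ext fun z => ?_
    induction z using Module.DirectLimit.induction_on with
    | _ j x =>
      rw [limAct_of F 1 (k := j) (fun x hx => hx)]
      have : stdHom (toEnd (1 : G n)) (preservesFlag_toEnd 1) (fun x hx => hx) =
        𝟙 (stdFlag (cst n j)) := rfl
      rw [this]
      simp [mapLin]
  map_mul' g h := by
    refine LinearMap.ext fun z => ?_
    induction z using Module.DirectLimit.induction_on with
    | _ j x =>
      obtain ⟨l, hl⟩ := exists_level h
      obtain ⟨m, hm⟩ := exists_level g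
      have h1 := hl.maps (le_max_left j l) (le_max_right j l)
      have h2 := hm.maps (le_max_left (max j l) m) (le_max_right (max j l) m)
      rw [Module.End.mul_apply, limAct_of F h h1, limAct_of F g h2, mapLin_comp,
        limAct_of F (g * h) (k := max (max j l) m) (fun x hx => h2 _ (h1 x hx))]
      rfl

variable {F} in
/-- The map on direct limits induced by a natural transformation. -/
def limMap {F' : FlagFunctor n} (η : F ⟶ F') : LimSpace F →ₗ[ℂ] LimSpace F' :=
  Module.DirectLimit.map (fun j => (η.app (stdFlag (cst n j))).hom.hom)
    (fun i j h => congrArg (fun f => f.hom.hom) (η.naturality (stdIncl (n := n)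
      (a := cst n i) (b := cst n j) fun _ => h)))

variable {F} in
theorem limMap_of {F' : FlagFunctor n} (η : F ⟶ F') (j : ℕ) (x : stdVal F (cst n j)) :
    limMap η (limOf F j x) = limOf F' j ((η.app (stdFlag (cst n j))).hom.hom x) :=
  Module.DirectLimit.map_apply_of _ _ _

end Limit

/-- The functor `F ↦ lim F(ℂ^{(jⁿ)})` (direct limit) from functors on flags to representations
of `𝐆`. -/
def limFunctor (n : ℕ) : FlagFunctor n ⥤ Rep.{0} ℂ (G n) where
  obj F := Rep.of (limRep F)
  map {F F'} η := Rep.ofHom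
    { toLinearMap := limMap η
      isIntertwining' := fun g => by
        refine LinearMap.ext fun z => ?_
        induction z using Module.DirectLimit.induction_on with
        | _ j x =>
          obtain ⟨l, hl⟩ := exists_level g
          have h1 := hl.maps (le_max_left j l) (le_max_right j l)
          rw [LinearMap.comp_apply, LinearMap.comp_apply]
          change limMap η (limAct F g (limOf F j x)) = limAct F' g (limMap η (limOf F j x))
          rw [limAct_of F g h1, limMap_of, limMap_of, limAct_of F' g h1]
          exact congrArg _ (congrArg (fun f => f.hom.hom x) (η.naturality
            (stdHom (toEnd g) (preservesFlag_toEnd g) h1))) }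
  map_id F := by
    refine Rep.hom_ext (Representation.IntertwiningMap.toLinearMap_injective _ _
      (LinearMap.ext fun z => ?_))
    induction z using Module.DirectLimit.induction_on with
    | _ j x => exact limMap_of (𝟙 F) j x
  map_comp {F F' F''} η θ := by
    refine Rep.hom_ext (Representation.IntertwiningMap.toLinearMap_injective _ _
      (LinearMap.ext fun z => ?_))
    induction z using Module.DirectLimit.induction_on with
    | _ j x =>
      change limMap (η ≫ θ) (limOf F j x) = limMap θ (limMap η (limOf F j x))
      rw [limMap_of, limMap_of, limMap_of]
      rfl

/-! ### The action of the monoid of endomorphisms on polynomial representations -/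

/-- A polynomial map between vector spaces: a finite sum of the maps `x ↦ c(x) • v`, where `c` is
in the algebra of functions generated by the linear functionals. -/
def IsPolyMap {E V : Type} [AddCommGroup E] [Module ℂ E] [AddCommGroup V] [Module ℂ V]
    (p : E → V) : Prop :=
  p ∈ Submodule.span ℂ {q : E → V |
    ∃ c ∈ Algebra.adjoin ℂ {φ : E → ℂ | ∃ l : E →ₗ[ℂ] ℂ, φ = l}, ∃ v : V, q = fun x => c x • v}

namespace IsPolyMap

variable {E E' V W : Type} [AddCommGroup E] [Module ℂ E] [AddCommGroup E'] [Module ℂ E']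
  [AddCommGroup V] [Module ℂ V] [AddCommGroup W] [Module ℂ W]

theorem add {p q : E → V} (hp : IsPolyMap p) (hq : IsPolyMap q) : IsPolyMap (p + q) :=
  Submodule.add_mem _ hp hq

theorem sub {p q : E → V} (hp : IsPolyMap p) (hq : IsPolyMap q) : IsPolyMap (p - q) :=
  Submodule.sub_mem _ hp hq

theorem smul (c : ℂ) {p : E → V} (hp : IsPolyMap p) : IsPolyMap (c • p) :=
  Submodule.smul_mem _ c hp

theorem sum {ι : Type} (s : Finset ι) {p : ι → E → V} (hp : ∀ i ∈ s, IsPolyMap (p i)) :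
    IsPolyMap (∑ i ∈ s, p i) :=
  Submodule.sum_mem _ hp

theorem const (v : V) : IsPolyMap (fun _ : E => v) :=
  Submodule.subset_span ⟨1, one_mem _, v, by simp⟩

theorem linear (l : E →ₗ[ℂ] ℂ) (v : V) : IsPolyMap (fun x => l x • v) :=
  Submodule.subset_span ⟨l, Algebra.subset_adjoin ⟨l, rfl⟩, v, rfl⟩

theorem map (f : V →ₗ[ℂ] W) {p : E → V} (hp : IsPolyMap p) : IsPolyMap (fun x => f (p x)) := by
  induction hp using Submodule.span_induction with
  | mem q hq =>
    obtain ⟨c, hc, v, rfl⟩ := hq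
    exact Submodule.subset_span ⟨c, hc, f v, by simp⟩
  | zero => simpa using const (E := E) (0 : W)
  | add p q _ _ hp hq => simpa using! hp.add hq
  | smul c p _ hp => simpa using! hp.smul c

theorem precomp (f : E' →ₗ[ℂ] E) {p : E → V} (hp : IsPolyMap p) :
    IsPolyMap (fun x => p (f x)) := by
  induction hp using Submodule.span_induction with
  | mem q hq =>
    obtain ⟨c, hc, v, rfl⟩ := hq
    refine Submodule.subset_span ⟨fun x => c (f x), ?_, v, rfl⟩
    induction hc using Algebra.adjoin_induction with
    | mem c hc =>
      obtain ⟨l, rfl⟩ := hc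
      exact Algebra.subset_adjoin ⟨l ∘ₗ f, rfl⟩
    | algebraMap r => exact Subalgebra.algebraMap_mem _ r
    | add c d _ _ hc hd => exact add_mem hc hd
    | mul c d _ _ hc hd => exact mul_mem hc hd
  | zero => exact const (E := E') (0 : V)
  | add p q _ _ hp hq => exact hp.add hq
  | smul c p _ hp => exact hp.smul c

theorem tmul {p : E → V} {q : E → W} (hp : IsPolyMap p) (hq : IsPolyMap q) :
    IsPolyMap (fun x => TensorProduct.tmul ℂ (p x) (q x)) := by
  induction hp using Submodule.span_induction with
  | mem p hp =>
    obtain ⟨c, hc, v, rfl⟩ := hp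
    induction hq using Submodule.span_induction with
    | mem q hq =>
      obtain ⟨d, hd, w, rfl⟩ := hq
      refine Submodule.subset_span ⟨c * d, mul_mem hc hd, TensorProduct.tmul ℂ v w, ?_⟩
      funext x
      simp only [TensorProduct.smul_tmul_smul, Pi.mul_apply]
    | zero => simpa using const (E := E) (0 : TensorProduct ℂ V W)
    | add p q _ _ hp hq => simpa [TensorProduct.tmul_add] using! hp.add hq
    | smul c p _ hp => simpa using! hp.smul c
  | zero => simpa using const (E := E) (0 : TensorProduct ℂ V W)
  | add p q _ _ hp hq => simpa [TensorProduct.add_tmul] using! hp.add hq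
  | smul c p _ hp => simpa [TensorProduct.smul_tmul'] using! hp.smul c

/-- On a line, a polynomial function is a polynomial in the parameter. -/
theorem exists_line (φ : V →ₗ[ℂ] ℂ) {p : E → V} (hp : IsPolyMap p) (a b : E) :
    ∃ Q : Polynomial ℂ, ∀ t : ℂ, φ (p (a + t • b)) = Q.eval t := by
  induction hp using Submodule.span_induction with
  | mem q hq =>
    obtain ⟨c, hc, v, rfl⟩ := hq
    have : ∃ Q : Polynomial ℂ, ∀ t : ℂ, c (a + t • b) = Q.eval t := by
      induction hc using Algebra.adjoin_induction with
      | mem c hc =>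
        obtain ⟨l, rfl⟩ := hc
        exact ⟨Polynomial.C (l a) + Polynomial.X * Polynomial.C (l b), fun t => by simp [mul_comm t]⟩
      | algebraMap r => exact ⟨Polynomial.C r, fun t => by simp⟩
      | add c d _ _ hc hd =>
        obtain ⟨Q, hQ⟩ := hc
        obtain ⟨R, hR⟩ := hd
        exact ⟨Q + R, fun t => by simp [hQ, hR]⟩
      | mul c d _ _ hc hd =>
        obtain ⟨Q, hQ⟩ := hc
        obtain ⟨R, hR⟩ := hd
        exact ⟨Q * R, fun t => by simp [hQ, hR]⟩
    obtain ⟨Q, hQ⟩ := this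
    exact ⟨Q * Polynomial.C (φ v), fun t => by simp [hQ]⟩
  | zero => exact ⟨0, fun t => by simp⟩
  | add p q _ _ hp hq =>
    obtain ⟨Q, hQ⟩ := hp
    obtain ⟨R, hR⟩ := hq
    exact ⟨Q + R, fun t => by simp [hQ, hR]⟩
  | smul c p _ hp =>
    obtain ⟨Q, hQ⟩ := hp
    exact ⟨Polynomial.C c * Q, fun t => by simp [hQ]⟩

end IsPolyMap

/-- An injective endomorphism of a finite level that preserves the flag belongs to `𝐆`. -/
theorem exists_toEnd_eq {n j : ℕ} {A : VInf n →ₗ[ℂ] VInf n} (hA : PreservesFlag A)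
    (hj : IsLevel j A) (h0 : ∀ x ∈ stdSub (cst n j), A x = 0 → x = 0) :
    ∃ g : G n, toEnd g = A := by
  have hinj : Function.Injective A := by
    rw [injective_iff_map_eq_zero]
    intro x hx
    obtain ⟨y, z, rfl, hy, hz, -⟩ := split_level j x
    rw [map_add, hj.fix hz] at hx
    have hz' : z ∈ stdSub (cst n j) := by
      rw [← neg_eq_of_add_eq_zero_right hx]
      exact neg_mem (hj.1 y hy)
    have hz0 : z = 0 := by
      have hd : Disjoint {p : Fin n × ℕ | p.2 < cst n j p.1} {p : Fin n × ℕ | j ≤ p.2} := by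
        rw [Set.disjoint_left]
        intro p hp hp'
        exact absurd (show j ≤ p.2 from hp') (not_le.2 hp)
      exact (Submodule.disjoint_def.1 (Finsupp.disjoint_supported_supported (R := ℂ) (M := ℂ) hd))
        z hz' hz
    subst hz0
    rw [add_zero] at hx ⊢
    exact h0 y hy hx
  have hsurj : ∀ i, ∀ x ∈ flagSub n i, ∃ y ∈ flagSub n i, A y = x ∧
      (x ∈ stdSub (cst n j) → y ∈ stdSub (cst n j)) := by
    intro i x hx
    obtain ⟨y, z, hxyz, hy, hz, hf⟩ := split_level j x
    have hm : ∀ w ∈ stdSub (cst n j) ⊓ flagSub n i, A w ∈ stdSub (cst n j) ⊓ flagSub n i :=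
      fun w hw => ⟨hj.1 w hw.1, hA i w hw.2⟩
    have : FiniteDimensional ℂ ↥(stdSub (cst n j) ⊓ flagSub n i) :=
      Submodule.finiteDimensional_inf_left _ _
    have hs : Function.Surjective (A.restrict hm) := by
      refine LinearMap.surjective_of_injective (K := ℂ)
        (V := ↥(stdSub (cst n j) ⊓ flagSub n i)) (f := A.restrict hm) ?_
      intro u v huv
      exact Subtype.ext (hinj (congrArg Subtype.val huv))
    obtain ⟨⟨w, hw⟩, hwy⟩ := hs ⟨y, hy, (hf i hx).1⟩
    have hwy' : A w = y := congrArg Subtype.val hwy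
    refine ⟨w + z, add_mem hw.2 (hf i hx).2, ?_, fun hx' => ?_⟩
    · rw [map_add, hwy', hj.fix hz, hxyz]
    · refine add_mem hw.1 ?_
      have : z = x - y := by rw [hxyz]; abel
      rw [this]
      exact sub_mem hx' hy
  have hsj : Function.Surjective A := by
    intro x
    obtain ⟨y, -, hy, -⟩ := hsurj (Fin.last n) x (by
      have h : flagSub n (Fin.last n) = ⊤ := by simp [flagSub]
      rw [h]; trivial)
    exact ⟨y, hy⟩
  let g : VInf n ≃ₗ[ℂ] VInf n := LinearEquiv.ofBijective A ⟨hinj, hsj⟩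
  refine ⟨⟨g, fun i => ?_, j, hj, fun x hx => ?_, fun p hp => ?_⟩, rfl⟩
  · refine le_antisymm (Submodule.map_le_iff_le_comap.2 fun x hx => hA i x hx) fun x hx => ?_
    obtain ⟨y, hy, hyx, -⟩ := hsurj i x hx
    exact ⟨y, hy, hyx⟩
  · obtain ⟨y, -, hy, hy'⟩ := hsurj (Fin.last n) x (by
      have h : flagSub n (Fin.last n) = ⊤ := by simp [flagSub]
      rw [h]; trivial)
    have : g.symm x = y := by rw [LinearEquiv.symm_apply_eq]; exact hy.symm
    change g.symm x ∈ _
    rw [this]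
    exact hy' hx
  · change g.symm _ = _
    rw [LinearEquiv.symm_apply_eq]
    exact (hj.2 p hp).symm

/-- A polynomial map that vanishes on the elements of `𝐆` of level `j` vanishes on all flag
preserving endomorphisms of level `j`. -/
theorem poly_vanish {n j : ℕ} {V : Type} [AddCommGroup V] [Module ℂ V]
    {p : (VInf n →ₗ[ℂ] VInf n) → V} (hp : IsPolyMap p)
    (h : ∀ g : G n, IsLevel j (toEnd g) → p (toEnd g) = 0)
    {A : VInf n →ₗ[ℂ] VInf n} (hA : PreservesFlag A) (hj : IsLevel j A) : p A = 0 := by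
  rw [← Module.forall_dual_apply_eq_zero_iff ℂ]
  intro φ
  obtain ⟨Q, hQ⟩ := hp.exists_line φ A (LinearMap.id - A)
  let S : Set ℂ := {μ | Module.End.HasEigenvalue (M := stdSub (cst n j)) (A.restrict hj.1) μ}
  have hS : S.Finite := Module.End.finite_hasEigenvalue _
  let T : Set ℂ := (fun μ => μ / (μ - 1)) '' S
  have hT : T.Finite := hS.image _
  have hroot : ∀ t ∈ Tᶜ, Q.IsRoot t := by
    intro t ht
    have hfl : PreservesFlag (A + t • (LinearMap.id - A)) := fun i x hx => by
      simp only [LinearMap.add_apply, LinearMap.smul_apply, LinearMap.sub_apply, LinearMap.id_apply]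
      exact add_mem (hA i x hx) (Submodule.smul_mem _ _ (sub_mem hx (hA i x hx)))
    have hlv : IsLevel j (A + t • (LinearMap.id - A)) := by
      refine ⟨fun x hx => ?_, fun p hp => ?_⟩
      · simp only [LinearMap.add_apply, LinearMap.smul_apply, LinearMap.sub_apply,
          LinearMap.id_apply]
        exact add_mem (hj.1 x hx) (Submodule.smul_mem _ _ (sub_mem hx (hj.1 x hx)))
      · simp [hj.2 p hp]
    obtain ⟨g, hg⟩ := exists_toEnd_eq hfl hlv (by
      intro x hx hx0
      by_contra hne
      simp only [LinearMap.add_apply, LinearMap.smul_apply, LinearMap.sub_apply,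
        LinearMap.id_apply] at hx0
      have h1 : (1 - t) • A x = (-t) • x := by
        have : (1 - t) • A x - (-t) • x = A x + t • (x - A x) := by module
        rw [← sub_eq_zero, this, hx0]
      have ht1 : 1 - t ≠ 0 := by
        intro h
        have : t = 1 := by linear_combination -h
        subst this
        simp at h1
        exact hne h1
      have h2 : A x = (-t / (1 - t)) • x := by
        rw [div_eq_inv_mul, mul_smul, ← h1, smul_smul, inv_mul_cancel₀ ht1, one_smul]
      refine ht ⟨-t / (1 - t), ?_, ?_⟩
      · refine Module.End.hasEigenvalue_of_hasEigenvector (x := (⟨x, hx⟩ : stdSub (cst n j)))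
          ⟨Module.End.mem_eigenspace_iff.2 (Subtype.ext h2), fun h => hne (congrArg Subtype.val h)⟩
      · simp only
        field_simp
        ring)
    rw [Polynomial.IsRoot, ← hQ, ← hg, h g (hg ▸ hlv), map_zero]
  have hQ0 : Q = 0 := Polynomial.eq_zero_of_infinite_isRoot Q
    (hT.infinite_compl.mono fun t ht => hroot t ht)
  have := hQ 0
  rw [hQ0] at this
  simpa using this

/-- The monoid of flag preserving endomorphisms of the standard representation that lie in some
finite level. Its unit group is `𝐆`. -/
def flagEnd (n : ℕ) : Submonoid (Module.End ℂ (VInf n)) where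
  carrier := {A | PreservesFlag A ∧ ∃ j, IsLevel j A}
  one_mem' := ⟨PreservesFlag.id, 0, IsLevel.id 0⟩
  mul_mem' := by
    rintro A B ⟨hA, j, hj⟩ ⟨hB, k, hk⟩
    exact ⟨hA.comp hB, max j k, (hj.mono (le_max_left _ _)).comp (hk.mono (le_max_right _ _))⟩

/-- `α` is an extension of the action of `𝐆` on `V` to the monoid of endomorphisms that is
polynomial on each finite level. (The endomorphisms of level `j` form an affine space of finite
dimension, on which the linear functionals are the affine functions of the finitely many matrix
entries; so polynomial means polynomial in the matrix entries.) -/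
structure IsEndAction {n : ℕ} (V : Rep.{0} ℂ (G n)) (α : flagEnd n →* Module.End ℂ V) : Prop where
  extends_action : ∀ (g : G n) (A : flagEnd n), (A : Module.End ℂ (VInf n)) = toEnd g →
    α A = V.ρ g
  polynomial : ∀ (j : ℕ) (x : V), ∃ p : Module.End ℂ (VInf n) → V, IsPolyMap p ∧
    ∀ A : flagEnd n, IsLevel j (A : Module.End ℂ (VInf n)) → α A x = p A

/-- On each finite level the orbit maps `g ↦ g x` are polynomial. -/
def HasPolyOrbits {n : ℕ} (V : Rep.{0} ℂ (G n)) : Prop :=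
  ∀ (j : ℕ) (x : V), ∃ p : Module.End ℂ (VInf n) → V, IsPolyMap p ∧
    ∀ g : G n, IsLevel j (toEnd g) → p (toEnd g) = V.ρ g x

namespace HasPolyOrbits

variable {n : ℕ} {V W : Rep.{0} ℂ (G n)}

theorem of_mono (f : V ⟶ W) [hf : Mono f] (h : HasPolyOrbits W) : HasPolyOrbits V := by
  intro j x
  obtain ⟨p, hp, hpg⟩ := h j (f.hom x)
  obtain ⟨r, hr⟩ := LinearMap.exists_leftInverse_of_injective f.hom.toLinearMap
    (LinearMap.ker_eq_bot.2 ((Rep.mono_iff_injective f).1 hf))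
  refine ⟨fun A => r (p A), hp.map r, fun g hg => ?_⟩
  simp only
  rw [hpg g hg, ← Rep.hom_comm_apply]
  exact LinearMap.congr_fun hr _

theorem of_epi (f : V ⟶ W) [hf : Epi f] (h : HasPolyOrbits V) : HasPolyOrbits W := by
  intro j y
  obtain ⟨x, rfl⟩ := (Rep.epi_iff_surjective f).1 hf y
  obtain ⟨p, hp, hpg⟩ := h j x
  refine ⟨fun A => f.hom (p A), hp.map f.hom.toLinearMap, fun g hg => ?_⟩
  simp only
  rw [hpg g hg, Rep.hom_comm_apply]

theorem unit : HasPolyOrbits (𝟙_ (Rep.{0} ℂ (G n))) :=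
  fun _ x => ⟨fun _ => x, IsPolyMap.const x, fun _ _ => rfl⟩

theorem tensor (hV : HasPolyOrbits V) (hW : HasPolyOrbits W) : HasPolyOrbits (V ⊗ W) := by
  intro j x
  change TensorProduct ℂ V W at x
  induction x using TensorProduct.induction_on with
  | zero => exact ⟨fun _ => 0, IsPolyMap.const _, fun g _ => (map_zero _).symm⟩
  | tmul x y =>
    obtain ⟨p, hp, hpg⟩ := hV j x
    obtain ⟨q, hq, hqg⟩ := hW j y
    refine ⟨fun A => TensorProduct.tmul ℂ (p A) (q A), hp.tmul hq, fun g hg => ?_⟩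
    simp only
    rw [hpg g hg, hqg g hg]
    rfl
  | add x y hx hy =>
    obtain ⟨p, hp, hpg⟩ := hx
    obtain ⟨q, hq, hqg⟩ := hy
    refine ⟨p + q, hp.add hq, fun g hg => ?_⟩
    rw [Pi.add_apply, hpg g hg, hqg g hg]
    exact (map_add ((V ⊗ W).ρ g) x y).symm

theorem std_aux (j : ℕ) (x : VInf n) : ∃ p : Module.End ℂ (VInf n) → VInf n, IsPolyMap p ∧
    ∀ g : G n, IsLevel j (toEnd g) → p (toEnd g) = toEnd g x := by
  classical
  let S : Finset (Fin n × ℕ) := (finite_stdSub_index (cst n j)).toFinset ∪ x.support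
  refine ⟨fun A => ∑ s ∈ S, (A x s) • (Finsupp.single s 1 : VInf n), ?_, fun g hg => ?_⟩
  · have : (fun A : Module.End ℂ (VInf n) => ∑ s ∈ S, (A x s) • (Finsupp.single s 1 : VInf n)) =
        ∑ s ∈ S, fun A : Module.End ℂ (VInf n) => (A x s) • (Finsupp.single s 1 : VInf n) := by
      funext A; simp
    rw [this]
    refine IsPolyMap.sum S fun s _ => ?_
    exact IsPolyMap.linear ((Finsupp.lapply s) ∘ₗ (LinearMap.applyₗ x)) _
  · have hmem : toEnd g x ∈ Finsupp.supported ℂ ℂ (S : Set (Fin n × ℕ)) := by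
      obtain ⟨y, z, hx, hy, hz, -⟩ := split_level j x
      have h1 : stdSub (cst n j) ≤ Finsupp.supported ℂ ℂ (S : Set (Fin n × ℕ)) :=
        Finsupp.supported_mono fun p hp => by simp [S]; exact Or.inl hp
      have h2 : x ∈ Finsupp.supported ℂ ℂ (S : Set (Fin n × ℕ)) := by
        rw [Finsupp.mem_supported]; simp [S]
      have h3 : toEnd g x = toEnd g y + (x - y) := by
        rw [hx, map_add, hg.fix hz]; abel
      rw [h3]
      exact add_mem (h1 (hg.1 y hy)) (sub_mem h2 (h1 hy))
    rw [Finsupp.mem_supported] at hmem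
    conv_rhs => rw [← Finsupp.sum_single (toEnd g x)]
    rw [Finsupp.sum_of_support_subset _ (Finset.coe_subset.1 hmem) _ (by simp)]
    exact Finset.sum_congr rfl fun s _ => by simp

theorem std : HasPolyOrbits (stdRep n) := fun j x => std_aux j x

theorem tensorPow (h : HasPolyOrbits V) : ∀ k, HasPolyOrbits (tensorPow V k)
  | 0 => unit
  | k + 1 => (tensorPow h k).tensor h

open Limits in
theorem biproduct {k : ℕ} (X : Fin k → Rep.{0} ℂ (G n)) (h : ∀ i, HasPolyOrbits (X i)) :
    HasPolyOrbits (⨁ X) := by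
  intro j x
  choose p hp hpg using fun i => h i j ((biproduct.π X i).hom x)
  refine ⟨∑ i, fun A => (biproduct.ι X i).hom (p i A),
    IsPolyMap.sum _ fun i _ => (hp i).map (biproduct.ι X i).hom.toLinearMap, fun g hg => ?_⟩
  rw [Finset.sum_apply]
  have htot : ∀ y : (⨁ X : Rep.{0} ℂ (G n)),
      ∑ i, (biproduct.ι X i).hom ((biproduct.π X i).hom y) = y := by
    intro y
    have h1 := congrArg (fun f => f.hom y) (biproduct.total (f := X))
    have h2 := congrArg (fun f => f.hom y)
      ((forget₂ (Rep.{0} ℂ (G n)) (ModuleCat ℂ)).map_sum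
        (fun i => biproduct.π X i ≫ biproduct.ι X i) Finset.univ)
    have h3 : (∑ i, (forget₂ (Rep.{0} ℂ (G n)) (ModuleCat ℂ)).map
        (biproduct.π X i ≫ biproduct.ι X i)).hom y =
        ∑ i, (biproduct.ι X i).hom ((biproduct.π X i).hom y) := by
      rw [ModuleCat.hom_sum, LinearMap.sum_apply]
      rfl
    rw [← h3]
    exact h2.symm.trans h1
  refine Eq.trans ?_ (htot ((⨁ X : Rep.{0} ℂ (G n)).ρ g x))
  refine Finset.sum_congr rfl fun i _ => ?_
  rw [hpg i g hg]
  exact congrArg _ (Rep.hom_comm_apply (biproduct.π X i) g x).symm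

theorem of_isPolyRep (h : isPolyRep n V) : HasPolyOrbits V := by
  obtain ⟨k, a, Z, i, q, hi, hq⟩ := h
  have h1 : HasPolyOrbits Z := of_mono i (biproduct _ fun i => tensorPow std (a i))
  exact of_epi q h1

end HasPolyOrbits

theorem endAction_unique {n : ℕ} {V : Rep.{0} ℂ (G n)} {α β : flagEnd n →* Module.End ℂ V}
    (hα : IsEndAction V α) (hβ : IsEndAction V β) : α = β := by
  ext A x
  obtain ⟨hfl, j, hj⟩ := A.2
  obtain ⟨p, hp, hpA⟩ := hα.polynomial j x
  obtain ⟨q, hq, hqA⟩ := hβ.polynomial j x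
  have hG : ∀ g : G n, toEnd g ∈ flagEnd n := fun g => ⟨preservesFlag_toEnd g, exists_level g⟩
  rw [hpA A hj, hqA A hj, ← sub_eq_zero]
  refine poly_vanish (hp.sub hq) (fun g hg => ?_) hfl hj
  rw [Pi.sub_apply, ← hpA ⟨toEnd g, hG g⟩ hg, ← hqA ⟨toEnd g, hG g⟩ hg,
    hα.extends_action g _ rfl, hβ.extends_action g _ rfl, sub_self]

theorem exists_endAction {n : ℕ} {V : Rep.{0} ℂ (G n)} (h : HasPolyOrbits V) :
    ∃ α : flagEnd n →* Module.End ℂ V, IsEndAction V α := by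
  choose p hp hpg using h
  let lv : flagEnd n → ℕ := fun A => A.2.2.choose
  have hlv : ∀ A : flagEnd n, IsLevel (lv A) (A : Module.End ℂ (VInf n)) :=
    fun A => A.2.2.choose_spec
  have key : ∀ (A : flagEnd n) (k : ℕ) (x : V) (q : Module.End ℂ (VInf n) → V),
      IsLevel k (A : Module.End ℂ (VInf n)) → IsPolyMap q →
      (∀ g : G n, IsLevel k (toEnd g) → q (toEnd g) = V.ρ g x) → p (lv A) x A = q A := by
    intro A k x q hk hq hqg
    rw [← sub_eq_zero]
    rcases le_total (lv A) k with hle | hle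
    · refine poly_vanish ((hp (lv A) x).sub hq) (fun g hg => ?_) A.2.1 (hlv A)
      rw [Pi.sub_apply, hpg _ _ g hg, hqg g (hg.mono hle), sub_self]
    · refine poly_vanish ((hp (lv A) x).sub hq) (fun g hg => ?_) A.2.1 hk
      rw [Pi.sub_apply, hpg _ _ g (hg.mono hle), hqg g hg, sub_self]
  have key' : ∀ (A : flagEnd n) (k : ℕ) (x : V), IsLevel k (A : Module.End ℂ (VInf n)) →
      p (lv A) x A = p k x A := fun A k x hk => key A k x (p k x) hk (hp k x) (hpg k x)
  let act : flagEnd n → Module.End ℂ V := fun A =>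
    { toFun := fun x => p (lv A) x A
      map_add' := fun x y => key A (lv A) (x + y) (p (lv A) x + p (lv A) y) (hlv A)
        ((hp _ _).add (hp _ _)) fun g hg => by
          rw [Pi.add_apply, hpg _ _ g hg, hpg _ _ g hg, map_add]
      map_smul' := fun c x => key A (lv A) (c • x) (c • p (lv A) x) (hlv A)
        ((hp _ _).smul c) fun g hg => by
          rw [Pi.smul_apply, hpg _ _ g hg, map_smul] }
  have act_apply : ∀ (A : flagEnd n) (k : ℕ) (x : V), IsLevel k (A : Module.End ℂ (VInf n)) →
      act A x = p k x A := key'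
  have act_g : ∀ (g : G n) (A : flagEnd n), (A : Module.End ℂ (VInf n)) = toEnd g →
      act A = V.ρ g := by
    intro g A hA
    ext x
    obtain ⟨k, hk⟩ := exists_level g
    rw [act_apply A k x (hA ▸ hk), hA, hpg k x g hk]
  refine ⟨⟨⟨act, ?_⟩, ?_⟩, ⟨act_g, fun j x => ⟨p j x, hp j x, fun A hA => act_apply A j x hA⟩⟩⟩
  · rw [act_g 1 1 rfl, map_one]
  · intro B A
    ext x
    obtain ⟨-, j, hj⟩ := A.2
    obtain ⟨-, k, hk⟩ := B.2
    have hA := hj.mono (le_max_left j k)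
    have hB := hk.mono (le_max_right j k)
    set l := max j k
    have claim : ∀ (g : G n), IsLevel l (toEnd g) → ∀ C : Module.End ℂ (VInf n),
        PreservesFlag C → IsLevel l C → V.ρ g (p l x C) = p l x (toEnd g ∘ₗ C) := by
      intro g hg C hCf hC
      rw [← sub_eq_zero]
      have e1 : IsPolyMap (fun C : Module.End ℂ (VInf n) => p l x (toEnd g ∘ₗ C)) :=
        (hp l x).precomp (E' := Module.End ℂ (VInf n))
          (LinearMap.llcomp ℂ (VInf n) (VInf n) (VInf n) (toEnd g))
      have e2 : IsPolyMap (fun C : Module.End ℂ (VInf n) => V.ρ g (p l x C)) :=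
        (hp l x).map (V.ρ g)
      refine poly_vanish (p := fun C => V.ρ g (p l x C) - p l x (toEnd g ∘ₗ C))
        (e2.sub e1) (fun g' hg' => ?_) hCf hC
      have h1 : toEnd g ∘ₗ toEnd g' = toEnd (g * g') := rfl
      rw [h1, hpg l x g' hg', hpg l x (g * g') (h1 ▸ hg.comp hg'), map_mul, Module.End.mul_apply,
        sub_self]
    have h2 : p l (p l x A) B = p l x ((B : Module.End ℂ (VInf n)) ∘ₗ A) := by
      rw [← sub_eq_zero]
      have e1 : IsPolyMap (fun C : Module.End ℂ (VInf n) =>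
          p l x (C ∘ₗ (A : Module.End ℂ (VInf n)))) :=
        (hp l x).precomp (E' := Module.End ℂ (VInf n))
          (LinearMap.lcomp ℂ (VInf n) (A : Module.End ℂ (VInf n)))
      refine poly_vanish (p := fun C => p l (p l x A) C - p l x (C ∘ₗ A))
        ((hp l _).sub e1)
        (fun g hg => ?_) B.2.1 hB
      rw [hpg l _ g hg, claim g hg A A.2.1 hA, sub_self]
    change act (B * A) x = act B (act A x)
    rw [act_apply A l x hA, act_apply B l _ hB, h2, act_apply (B * A) l x (hB.comp hA)]
    rfl

/-- The action of the monoid of endomorphisms on a polynomial representation, obtained from the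
polynomial entries of the action of `𝐆`; it is the unique one with `IsEndAction`. -/
def endAction {n : ℕ} (V : PolyRep n) : flagEnd n →* Module.End ℂ V.obj :=
  (exists_endAction (HasPolyOrbits.of_isPolyRep V.property)).choose

theorem endAction_spec {n : ℕ} (V : PolyRep n) : IsEndAction V.obj (endAction V) :=
  (exists_endAction (HasPolyOrbits.of_isPolyRep V.property)).choose_spec

theorem endAction_toEnd {n : ℕ} (V : PolyRep n) (g : G n) (A : flagEnd n)
    (hA : (A : Module.End ℂ (VInf n)) = toEnd g) (x : V.obj) :
    endAction V A x = V.obj.ρ g x := by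
  rw [(endAction_spec V).extends_action g A hA]

/-- Morphisms of polynomial representations commute with the action of the endomorphisms. -/
theorem endAction_natural {n : ℕ} {V W : PolyRep n} (f : V ⟶ W) (A : flagEnd n) (x : V.obj) :
    f.hom.hom (endAction V A x) = endAction W A (f.hom.hom x) := by
  obtain ⟨hfl, j, hj⟩ := A.2
  obtain ⟨p, hp, hpA⟩ := (endAction_spec V).polynomial j x
  obtain ⟨q, hq, hqA⟩ := (endAction_spec W).polynomial j (f.hom.hom x)
  have hG : ∀ g : G n, toEnd g ∈ flagEnd n := fun g => ⟨preservesFlag_toEnd g, exists_level g⟩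
  rw [hpA A hj, hqA A hj, ← sub_eq_zero]
  refine poly_vanish (p := fun A => f.hom.hom (p A) - q A)
    ((hp.map f.hom.hom.toLinearMap).sub hq) (fun g hg => ?_) hfl hj
  rw [← hpA ⟨toEnd g, hG g⟩ hg, ← hqA ⟨toEnd g, hG g⟩ hg, endAction_toEnd V g _ rfl,
    endAction_toEnd W g _ rfl, Rep.hom_comm_apply, sub_self]

/-! ### The functor of invariants -/

/-- The subgroup `H_a` of `𝐆`: the block diagonal matrices whose `i`-th diagonal block fixes the
first `aᵢ` basis vectors and maps the span of the remaining basis vectors to itself. -/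
def H {n : ℕ} (a : Fin n → ℕ) : Subgroup (G n) where
  carrier := {g | (∀ x ∈ stdSub a, toEnd g x = x) ∧
    ∀ i : Fin n, (Finsupp.supported ℂ ℂ {p : Fin n × ℕ | p.1 = i ∧ a i ≤ p.2}).map (toEnd g) =
      Finsupp.supported ℂ ℂ {p : Fin n × ℕ | p.1 = i ∧ a i ≤ p.2}}
  one_mem' := ⟨fun _ _ => rfl, fun _ => Submodule.map_id _⟩
  mul_mem' := by
    rintro g h ⟨hg, hg'⟩ ⟨hh, hh'⟩
    have e : toEnd (g * h) = toEnd g ∘ₗ toEnd h := rfl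
    refine ⟨fun x hx => ?_, fun i => ?_⟩
    · rw [e, LinearMap.comp_apply, hh x hx, hg x hx]
    · rw [e, Submodule.map_comp, hh', hg']
  inv_mem' := by
    rintro g ⟨hg, hg'⟩
    have e : toEnd g⁻¹ ∘ₗ toEnd g = LinearMap.id := by
      change toEnd (g⁻¹ * g) = _
      rw [inv_mul_cancel]; rfl
    refine ⟨fun x hx => ?_, fun i => ?_⟩
    · conv_lhs => rw [← hg x hx]
      exact LinearMap.congr_fun e x
    · conv_lhs => rw [← hg' i]
      rw [← Submodule.map_comp, e, Submodule.map_id]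

/-- The space `V^{H_a}` of invariants. -/
def invariants {n : ℕ} (V : Rep.{0} ℂ (G n)) (a : Fin n → ℕ) : Submodule ℂ V where
  carrier := {x | ∀ g ∈ H a, V.ρ g x = x}
  add_mem' := fun hx hy g hg => by rw [map_add, hx g hg, hy g hg]
  zero_mem' := fun g _ => map_zero _
  smul_mem' := fun c x hx g hg => by rw [map_smul, hx g hg]

/-- A level that contains `ℂ^a` and `ℂ^b`. -/
def lvl {n : ℕ} (a b : Fin n → ℕ) : ℕ := Finset.univ.sup a ⊔ Finset.univ.sup b

/-- The linear map `ℂ^a → ℂ^b` underlying a morphism of flags. -/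
def stdLin {n : ℕ} {a b : Fin n → ℕ} (f : stdFlag a ⟶ stdFlag b) : stdSub a →ₗ[ℂ] stdSub b :=
  f.toLin

/-- The endomorphism of the standard representation that extends a morphism `f : ℂ^a ⟶ ℂ^b`:
it kills the basis vectors of `ℂ^{(jⁿ)}` outside `ℂ^a` and fixes the basis vectors outside
`ℂ^{(jⁿ)}`, where `j` is the maximum of the entries of `a` and `b`. -/
def extendLin {n : ℕ} {a b : Fin n → ℕ} (f : stdFlag a ⟶ stdFlag b) : VInf n →ₗ[ℂ] VInf n :=
  Finsupp.linearCombination ℂ fun p : Fin n × ℕ =>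
    if h : p.2 < a p.1 then
      (stdLin f ⟨Finsupp.single p 1, single_mem_stdSub h 1⟩ : VInf n)
    else if p.2 < lvl a b then 0 else Finsupp.single p 1

theorem linMap_eqOn_stdSub {n : ℕ} {a : Fin n → ℕ} {M : Type} [AddCommGroup M] [Module ℂ M]
    {A B : VInf n →ₗ[ℂ] M}
    (h : ∀ p : Fin n × ℕ, p.2 < a p.1 → A (Finsupp.single p 1) = B (Finsupp.single p 1)) :
    ∀ x ∈ stdSub a, A x = B x := by
  intro x hx
  rw [stdSub, Finsupp.supported_eq_span_single] at hx
  induction hx using Submodule.span_induction with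
  | mem x hx => obtain ⟨p, hp, rfl⟩ := hx; exact h p hp
  | zero => simp
  | add x y _ _ hx hy => rw [map_add, map_add, hx, hy]
  | smul c x _ hx => rw [map_smul, map_smul, hx]

theorem preservesFlag_of_single {n : ℕ} {A : VInf n →ₗ[ℂ] VInf n}
    (h : ∀ i, ∀ p : Fin n × ℕ, (p.1 : ℕ) < (i : Fin (n + 1)) →
      A (Finsupp.single p 1) ∈ flagSub n i) : PreservesFlag A := by
  intro i
  change flagSub n i ≤ (flagSub n i).comap A
  conv_lhs => rw [flagSub, Finsupp.supported_eq_span_single]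
  rw [Submodule.span_le]
  rintro _ ⟨p, hp, rfl⟩
  exact h i p hp

theorem single_mem_flagSub {n : ℕ} {i : Fin (n + 1)} {p : Fin n × ℕ} (h : (p.1 : ℕ) < i) (c : ℂ) :
    Finsupp.single p c ∈ flagSub n i :=
  Finsupp.single_mem_supported ℂ c h

theorem extendLin_single {n : ℕ} {a b : Fin n → ℕ} (f : stdFlag a ⟶ stdFlag b)
    (p : Fin n × ℕ) : extendLin f (Finsupp.single p 1) =
      if h : p.2 < a p.1 then
        (stdLin f ⟨Finsupp.single p 1, single_mem_stdSub h 1⟩ : VInf n)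
      else if p.2 < lvl a b then 0 else Finsupp.single p 1 := by
  rw [extendLin, Finsupp.linearCombination_single, one_smul]

theorem extendLin_apply {n : ℕ} {a b : Fin n → ℕ} (f : stdFlag a ⟶ stdFlag b) (x : stdSub a) :
    extendLin f x = stdLin f x := by
  have hx := x.2
  obtain ⟨x, hx'⟩ := x
  let r : VInf n →ₗ[ℂ] stdSub a := Finsupp.restrictDom ℂ ℂ {p : Fin n × ℕ | p.2 < a p.1}
  have hr : ∀ y : stdSub a, r y = y := fun y =>
    LinearMap.congr_fun (Finsupp.restrictDom_comp_subtype (M := ℂ) (R := ℂ) _) y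
  have key := linMap_eqOn_stdSub (a := a) (A := extendLin f)
    (B := (stdSub b).subtype ∘ₗ stdLin f ∘ₗ r) (fun p hp => by
      rw [extendLin_single, dif_pos hp]
      have h := hr ⟨Finsupp.single p 1, single_mem_stdSub hp 1⟩
      exact (congrArg (fun y => (stdLin f y : VInf n)) h).symm) x hx
  exact key.trans (congrArg (fun y => (stdLin f y : VInf n)) (hr ⟨x, hx'⟩))

theorem le_lvl_left {n : ℕ} (a b : Fin n → ℕ) : a ≤ cst n (lvl a b) :=
  fun i => (Finset.le_sup (f := a) (Finset.mem_univ i)).trans le_sup_left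

theorem le_lvl_right {n : ℕ} (a b : Fin n → ℕ) : b ≤ cst n (lvl a b) :=
  fun i => (Finset.le_sup (f := b) (Finset.mem_univ i)).trans le_sup_right

theorem extendLin_mem {n : ℕ} {a b : Fin n → ℕ} (f : stdFlag a ⟶ stdFlag b) :
    extendLin f ∈ flagEnd n := by
  refine ⟨preservesFlag_of_single fun i p hp => ?_, lvl a b, fun x hx => ?_, fun p hp => ?_⟩
  · rw [extendLin_single]
    split_ifs with h1 h2
    · exact f.map_fil i _ (single_mem_flagSub hp 1)
    · exact zero_mem _
    · exact single_mem_flagSub hp 1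
  · refine stdSub_induction (W := (stdSub (cst n (lvl a b))).comap (extendLin f))
      (fun p hp => ?_) hx
    rw [Submodule.mem_comap, extendLin_single]
    split_ifs with h1
    · exact stdSub_mono (le_lvl_right a b) (stdLin f _).2
    · exact zero_mem _
  · rw [extendLin_single, dif_neg (fun h => absurd (h.trans_le (le_lvl_left a b p.1)) hp.not_gt),
      if_neg hp.not_gt]

/-- The element of the monoid of endomorphisms extending a morphism `ℂ^a ⟶ ℂ^b`. -/
def extend {n : ℕ} {a b : Fin n → ℕ} (f : stdFlag a ⟶ stdFlag b) : flagEnd n :=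
  ⟨extendLin f, extendLin_mem f⟩

/-- The diagonal endomorphism that multiplies by `t` the basis vectors of `ℂ^{(jⁿ)}` outside
`ℂ^a`, and fixes all others. -/
def diagLin {n : ℕ} (a : Fin n → ℕ) (j : ℕ) (t : ℂ) : VInf n →ₗ[ℂ] VInf n :=
  Finsupp.linearCombination ℂ fun p : Fin n × ℕ =>
    (if p.2 < a p.1 then 1 else if p.2 < j then t else 1 : ℂ) • Finsupp.single p (1 : ℂ)

theorem diagLin_single {n : ℕ} (a : Fin n → ℕ) (j : ℕ) (t : ℂ) (p : Fin n × ℕ) :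
    diagLin a j t (Finsupp.single p 1) =
      (if p.2 < a p.1 then 1 else if p.2 < j then t else 1 : ℂ) • Finsupp.single p (1 : ℂ) := by
  rw [diagLin, Finsupp.linearCombination_single, one_smul]

theorem linMap_ext {n : ℕ} {M : Type} [AddCommGroup M] [Module ℂ M] {A B : VInf n →ₗ[ℂ] M}
    (h : ∀ p : Fin n × ℕ, A (Finsupp.single p 1) = B (Finsupp.single p 1)) : A = B :=
  Finsupp.lhom_ext' fun p => LinearMap.ext_ring (h p)

theorem diagLin_level {n : ℕ} {a : Fin n → ℕ} {j : ℕ} (t : ℂ) :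
    IsLevel j (diagLin a j t) := by
  refine ⟨fun x hx => ?_, fun p hp => ?_⟩
  · refine stdSub_induction (W := (stdSub (cst n j)).comap (diagLin a j t)) (fun p hp => ?_) hx
    rw [Submodule.mem_comap, diagLin_single]
    exact Submodule.smul_mem _ _ (single_mem_stdSub hp 1)
  · rw [diagLin_single]
    simp [hp.not_gt]

theorem diagLin_flag {n : ℕ} (a : Fin n → ℕ) (j : ℕ) (t : ℂ) : PreservesFlag (diagLin a j t) :=
  preservesFlag_of_single fun i p hp => by
    rw [diagLin_single]
    exact Submodule.smul_mem _ _ (single_mem_flagSub hp 1)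

theorem diagLin_mul_inv {n : ℕ} (a : Fin n → ℕ) (j : ℕ) {t : ℂ} (ht : t ≠ 0) :
    diagLin a j t ∘ₗ diagLin a j t⁻¹ = LinearMap.id := by
  refine linMap_ext fun p => ?_
  rw [LinearMap.comp_apply, diagLin_single, map_smul, diagLin_single, smul_smul]
  split_ifs <;> simp [ht]

/-- For `t ≠ 0`, the diagonal endomorphism belongs to `H_a`. -/
theorem diagLin_H {n : ℕ} (a : Fin n → ℕ) (j : ℕ) {t : ℂ} (ht : t ≠ 0) :
    ∃ g ∈ H a, toEnd g = diagLin a j t := by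
  obtain ⟨g, hg⟩ := exists_toEnd_eq (diagLin_flag a j t) (diagLin_level (a := a) (j := j) t)
    (fun x _ hx => by
      have h := LinearMap.congr_fun (diagLin_mul_inv a j (inv_ne_zero ht)) x
      rw [inv_inv, LinearMap.comp_apply, hx, map_zero] at h
      exact h.symm)
  have hle : ∀ (t : ℂ) (i : Fin n),
      (Finsupp.supported ℂ ℂ {p : Fin n × ℕ | p.1 = i ∧ a i ≤ p.2}).map (diagLin a j t) ≤
        Finsupp.supported ℂ ℂ {p : Fin n × ℕ | p.1 = i ∧ a i ≤ p.2} := by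
    intro t i
    rw [Submodule.map_le_iff_le_comap]
    conv_lhs => rw [Finsupp.supported_eq_span_single]
    rw [Submodule.span_le]
    rintro _ ⟨p, hp, rfl⟩
    change diagLin a j t _ ∈ Finsupp.supported ℂ ℂ {p : Fin n × ℕ | p.1 = i ∧ a i ≤ p.2}
    rw [diagLin_single]
    exact Submodule.smul_mem _ _ (Finsupp.single_mem_supported ℂ 1 hp)
  refine ⟨g, ⟨fun x hx => ?_, fun i => ?_⟩, hg⟩
  · rw [hg]
    refine linMap_eqOn_stdSub (B := LinearMap.id) (fun p hp => ?_) x hx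
    rw [diagLin_single, if_pos hp, one_smul]
    rfl
  · rw [hg]
    refine le_antisymm (hle t i) ?_
    conv_lhs => rw [← Submodule.map_id (Finsupp.supported ℂ ℂ {p : Fin n × ℕ | p.1 = i ∧ a i ≤ p.2}),
      ← diagLin_mul_inv a j ht, Submodule.map_comp]
    exact Submodule.map_mono (hle t⁻¹ i)

/-- The projection to `ℂ^a` acts as the identity on the invariants of `H_a`. -/
theorem endAction_proj {n : ℕ} (V : PolyRep n) {a : Fin n → ℕ} (j : ℕ)
    {x : V.obj} (hx : x ∈ invariants V.obj a) (A : flagEnd n)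
    (hA : (A : Module.End ℂ (VInf n)) = diagLin a j 0) : endAction V A x = x := by
  obtain ⟨p, hp, hpA⟩ := (endAction_spec V).polynomial j x
  rw [← sub_eq_zero, ← Module.forall_dual_apply_eq_zero_iff ℂ]
  intro φ
  have hline : ∀ t : ℂ, diagLin a j 0 + t • (LinearMap.id - diagLin a j 0) = diagLin a j t := by
    intro t
    refine linMap_ext fun q => ?_
    simp only [LinearMap.add_apply, LinearMap.smul_apply, LinearMap.sub_apply, LinearMap.id_apply,
      diagLin_single]
    split_ifs <;> simp
  obtain ⟨Q, hQ⟩ := hp.exists_line φ (diagLin a j 0) (LinearMap.id - diagLin a j 0)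
  have hroot : ∀ t ∈ ({0} : Set ℂ)ᶜ, (Q - Polynomial.C (φ x)).IsRoot t := by
    intro t ht
    obtain ⟨g, hgH, hg⟩ := diagLin_H a j (t := t) ht
    have hG : toEnd g ∈ flagEnd n := ⟨preservesFlag_toEnd g, exists_level g⟩
    have hl : IsLevel j (toEnd g) := by rw [hg]; exact diagLin_level t
    have h1 := hpA ⟨toEnd g, hG⟩ hl
    rw [endAction_toEnd V g _ rfl, hx g hgH] at h1
    rw [Polynomial.IsRoot, Polynomial.eval_sub, Polynomial.eval_C, ← hQ, hline, ← hg, ← h1,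
      sub_self]
  have hQ0 : Q - Polynomial.C (φ x) = 0 := Polynomial.eq_zero_of_infinite_isRoot _
    ((Set.finite_singleton (0 : ℂ)).infinite_compl.mono fun t ht => hroot t ht)
  have h0 := hQ 0
  rw [sub_eq_zero.1 hQ0, Polynomial.eval_C, hline, ← hA,
    ← hpA A (by rw [hA]; exact diagLin_level 0)] at h0
  rw [map_sub, h0, sub_self]

/-- The action on the invariants of `H_a` depends only on the restriction to `ℂ^a`. -/
theorem endAction_congr {n : ℕ} (V : PolyRep n) {a : Fin n → ℕ}
    {x : V.obj} (hx : x ∈ invariants V.obj a) (A B : flagEnd n)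
    (hAB : ∀ y ∈ stdSub a, (A : Module.End ℂ (VInf n)) y = (B : Module.End ℂ (VInf n)) y) :
    endAction V A x = endAction V B x := by
  obtain ⟨-, j, hj⟩ := A.2
  obtain ⟨-, k, hk⟩ := B.2
  have hj := hj.mono (le_max_left j k)
  have hk := hk.mono (le_max_right j k)
  set l := max j k
  let P : flagEnd n := ⟨diagLin a l 0, diagLin_flag a l 0, l, diagLin_level 0⟩
  have hP : endAction V P x = x := endAction_proj V l hx P rfl
  have hcomp : A * P = B * P := by
    refine Subtype.ext (linMap_ext fun p => ?_)
    change (A : Module.End ℂ (VInf n)) (diagLin a l 0 _) =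
      (B : Module.End ℂ (VInf n)) (diagLin a l 0 _)
    rw [diagLin_single, map_smul, map_smul]
    split_ifs with h1 h2
    · rw [hAB _ (single_mem_stdSub h1 1)]
    · rw [zero_smul, zero_smul]
    · rw [hj.2 p (not_lt.1 h2), hk.2 p (not_lt.1 h2)]
  calc endAction V A x = endAction V (A * P) x := by
        rw [map_mul, Module.End.mul_apply, hP]
    _ = endAction V B x := by rw [hcomp, map_mul, Module.End.mul_apply, hP]

theorem endAction_extend_mem {n : ℕ} (V : PolyRep n) {a b : Fin n → ℕ}
    (f : stdFlag a ⟶ stdFlag b) {x : V.obj} (hx : x ∈ invariants V.obj a) :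
    endAction V (extend f) x ∈ invariants V.obj b := by
  intro g hg
  have hG : toEnd g ∈ flagEnd n := ⟨preservesFlag_toEnd g, exists_level g⟩
  rw [← endAction_toEnd V g ⟨toEnd g, hG⟩ rfl, ← Module.End.mul_apply, ← map_mul]
  refine endAction_congr V hx _ _ fun y hy => ?_
  change toEnd g (extendLin f y) = extendLin f y
  rw [extendLin_apply f ⟨y, hy⟩]
  exact hg.1 _ (stdLin f _).2

/-- The category of the standard flags `ℂ^a`, a full subcategory of the category of flags. -/
abbrev StdFlag (n : ℕ) := InducedCategory (FlagCat n) (fun a : Fin n → ℕ => stdFlag a)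

/-- The inclusion of the standard flags into all flags. -/
abbrev stdIncFunctor (n : ℕ) : StdFlag n ⥤ FlagCat n := inducedFunctor _

/-- The functor `V ↦ (ℂ^a ↦ V^{H_a})` on polynomial representations; a morphism `f : ℂ^a ⟶ ℂ^b`
acts on invariants through an endomorphism of the standard representation that extends `f`. -/
def invFunctor (n : ℕ) : PolyRep n ⥤ (StdFlag n ⥤ ModuleCat ℂ) where
  obj V :=
    { obj := fun a => ModuleCat.of ℂ (invariants V.obj a)
      map := fun {a b} f => ModuleCat.ofHom
        ((endAction V (extend f.hom)).restrict fun _ hx => endAction_extend_mem V f.hom hx)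
      map_id := fun a => by
        ext x
        change endAction V (extend (𝟙 (stdFlag a))) x = x
        refine (endAction_congr V x.2 _ 1 fun y hy => ?_).trans ?_
        · exact extendLin_apply (𝟙 (stdFlag a)) ⟨y, hy⟩
        · rw [map_one]; rfl
      map_comp := fun {a b c} f g => by
        ext x
        change endAction V (extend (f.hom ≫ g.hom)) x =
          endAction V (extend g.hom) (endAction V (extend f.hom) x)
        rw [← Module.End.mul_apply, ← map_mul]
        refine endAction_congr V x.2 _ _ fun y hy => ?_
        change extendLin (f.hom ≫ g.hom) y = extendLin g.hom (extendLin f.hom y)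
        rw [extendLin_apply (f.hom ≫ g.hom) ⟨y, hy⟩, extendLin_apply f.hom ⟨y, hy⟩]
        exact (extendLin_apply g.hom _).symm }
  map {V W} φ :=
    { app := fun a => ModuleCat.ofHom (φ.hom.hom.toLinearMap.restrict
        (p := invariants V.obj a) (q := invariants W.obj a) fun x hx g hg => by
          change W.obj.ρ g (φ.hom.hom x) = φ.hom.hom x
          rw [← Rep.hom_comm_apply, hx g hg])
      naturality := fun a b f => by
        ext x
        exact endAction_natural φ (extend f.hom) x }
  map_id V := rfl
  map_comp φ ψ := rfl

/-- The restriction of a polynomial functor to the standard flags. -/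
def restrictStd (n : ℕ) : PolyFunctor n ⥤ (StdFlag n ⥤ ModuleCat ℂ) :=
  (isPolyFunctor n).ι ⋙ (Functor.whiskeringLeft _ _ _).obj (stdIncFunctor n) ⋙
    (Functor.whiskeringRight _ _ _).obj (forget₂ (FGModuleCat ℂ) (ModuleCat ℂ))

/-- The functor `Φ`: `F ↦ lim F(ℂ^{(jⁿ)})` from polynomial functors to polynomial representations,
for a proof `h` that the direct limits are polynomial. -/
abbrev Phi (n : ℕ) (h : ∀ F : PolyFunctor n, isPolyRep n ((limFunctor n).obj F.obj)) :
    PolyFunctor n ⥤ PolyRep n :=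
  (isPolyRep n).lift ((isPolyFunctor n).ι ⋙ limFunctor n) h

/-- The canonical map `F(ℂ^{(jⁿ)}) → Φ(F)`. -/
def toPhi {n : ℕ} (h : ∀ F : PolyFunctor n, isPolyRep n ((limFunctor n).obj F.obj))
    (F : PolyFunctor n) (j : ℕ) :
    (F.obj.obj (stdFlag (cst n j))).obj →ₗ[ℂ] ((Phi n h).obj F).obj :=
  limOf F.obj j

/-- For a functor `Ψ` with an identification `θ` of `Ψ(V)(ℂ^a)` with `V^{H_a}`, the resulting map
`Ψ(V)(ℂ^a) → V`. -/
def fromPsi {n : ℕ} {Ψ : PolyRep n ⥤ PolyFunctor n} (θ : Ψ ⋙ restrictStd n ≅ invFunctor n)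
    (V : PolyRep n) (a : Fin n → ℕ) :
    ((Ψ.obj V).obj.obj (stdFlag a)).obj →ₗ[ℂ] V.obj :=
  (invariants V.obj a).subtype ∘ₗ ((θ.hom.app V).app a).hom

end

end FlagSchur

open FlagSchur

/-!
The value `F(ℂ^a)` is the space of `H_a`-invariants in the direct limit `Φ(F)`: on an invariant
vector the idempotent of `𝐕` that projects onto `ℂ^a` acts as the identity, since a polynomial
action cannot distinguish this idempotent from the elements of `H_a`. Hence taking invariants
after `Φ` is restriction to the standard flags, which is fully faithful because every flag is a
retract of a standard one. Taking invariants is itself faithful, so `Φ` is fully faithful.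

It is essentially surjective because every subrepresentation of a direct limit `Φ(F)` is the direct
limit of a subfunctor of `F`, and likewise for quotients, while `Φ` sends tensor powers to tensor
powers. The direct limit commutes with tensor products, so `Φ` is a symmetric monoidal equivalence,
and its inverse `Ψ` inherits the symmetric monoidal structure.
-/

namespace FlagSchur

noncomputable section

section Category

open Limits

section Polynomial

universe v v' u u'

variable {C : Type u} [Category.{v} C] [MonoidalCategory C]
  {D : Type u'} [Category.{v'} D] [MonoidalCategory D]

/-- A monoidal functor commutes with tensor powers. -/
def mapTensorPow (K : C ⥤ D) [K.Monoidal] {S : C} {T : D} (e : K.obj S ≅ T) :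
    (k : ℕ) → (K.obj (tensorPow S k) ≅ tensorPow T k)
  | 0 => (Functor.Monoidal.εIso K).symm
  | k + 1 => (Functor.Monoidal.μIso K (tensorPow S k) S).symm ≪≫
      tensorIso (mapTensorPow K e k) e

variable [Preadditive C] [HasFiniteBiproducts C] [Preadditive D] [HasFiniteBiproducts D]

/-- An additive monoidal functor commutes with finite direct sums of tensor powers. -/
def mapSumTensorPow (K : C ⥤ D) [K.Monoidal] [K.Additive] {S : C} {T : D} (e : K.obj S ≅ T) {k : ℕ}
    (a : Fin k → ℕ) : K.obj (⨁ fun s => tensorPow S (a s)) ≅ ⨁ fun s => tensorPow T (a s) :=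
  have := K.preservesFiniteBiproductsOfAdditive
  K.mapBiproduct _ ≪≫ biproduct.mapIso fun s => mapTensorPow K e (a s)

theorem isPolynomial_biproduct_tensorPow (T : C) {k : ℕ} (a : Fin k → ℕ) :
    isPolynomial T (⨁ fun s => tensorPow T (a s)) :=
  ⟨k, a, _, 𝟙 _, 𝟙 _, inferInstance, inferInstance⟩

theorem isPolynomial_map (K : C ⥤ D) [K.Monoidal] [K.Additive] [K.PreservesMonomorphisms]
    [K.PreservesEpimorphisms] {S : C} {T : D} (e : K.obj S ≅ T) {X : C} (hX : isPolynomial S X) :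
    isPolynomial T (K.obj X) := by
  obtain ⟨k, a, Z, i, q, _, _⟩ := hX
  exact ⟨k, a, K.obj Z, K.map i ≫ (mapSumTensorPow K e a).hom, K.map q, inferInstance,
    inferInstance⟩

theorem isPolynomial_of_epi {T X Y : C} (q : X ⟶ Y) [Epi q] (hX : isPolynomial T X) :
    isPolynomial T Y := by
  obtain ⟨k, a, Z, i, p, hi, _⟩ := hX
  exact ⟨k, a, Z, i, p ≫ q, hi, inferInstance⟩

end Polynomial

theorem isPolynomial_of_mono {C : Type*} [Category C] [MonoidalCategory C] [Abelian C]
    [HasFiniteBiproducts C] {T X Y : C} (m : X ⟶ Y) [Mono m] (hY : isPolynomial T Y) :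
    isPolynomial T X := by
  obtain ⟨k, a, Z, i, p, _, _⟩ := hY
  exact ⟨k, a, pullback p m, pullback.fst p m ≫ i, pullback.snd p m, inferInstance, inferInstance⟩

section Restriction

variable {C₀ C : Type*} [Category C₀] [Category C] (ι : C₀ ⥤ C) (D : Type*) [Category D]

theorem whiskeringLeft_obj_faithful_of_retract
    (hι : ∀ U : C, ∃ X : C₀, Nonempty (Retract U (ι.obj X))) :
    ((Functor.whiskeringLeft C₀ C D).obj ι).Faithful where
  map_injective {F F'} η θ h := by
    ext U
    obtain ⟨X, ⟨r⟩⟩ := hι U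
    rw [← cancel_mono (r.map F').i]
    exact (η.naturality r.i).symm.trans
      ((congrArg (F.map r.i ≫ ·) (NatTrans.congr_app h X)).trans (θ.naturality r.i))

theorem whiskeringLeft_obj_full_of_retract [ι.Full]
    (hι : ∀ U : C, ∃ X : C₀, Nonempty (Retract U (ι.obj X))) :
    ((Functor.whiskeringLeft C₀ C D).obj ι).Full where
  map_surjective {F F'} η := by
    choose X ret using hι
    let r (U : C) : Retract U (ι.obj (X U)) := (ret U).some
    have map_naturality {Y Y' : C₀} (f : ι.obj Y ⟶ ι.obj Y') :
        F.map f ≫ η.app Y' = η.app Y ≫ F'.map f := by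
      obtain ⟨f, rfl⟩ := ι.map_surjective f
      exact η.naturality f
    refine ⟨{ app U := F.map (r U).i ≫ η.app (X U) ≫ F'.map (r U).r, naturality U V f := ?_ }, ?_⟩
    · have h := map_naturality ((r U).r ≫ f ≫ (r V).i)
      calc F.map f ≫ F.map (r V).i ≫ η.app (X V) ≫ F'.map (r V).r
          = F.map (r U).i ≫ (F.map ((r U).r ≫ f ≫ (r V).i) ≫ η.app (X V)) ≫ F'.map (r V).r := by
            simp only [← F.map_comp_assoc, Category.assoc, (r U).retract_assoc]
        _ = (F.map (r U).i ≫ η.app (X U) ≫ F'.map (r U).r) ≫ F'.map f := by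
            simp only [h, ← F'.map_comp, Category.assoc, (r V).retract, Category.comp_id]
    · ext Y
      calc F.map (r (ι.obj Y)).i ≫ η.app (X (ι.obj Y)) ≫ F'.map (r (ι.obj Y)).r
          = η.app Y ≫ F'.map ((r (ι.obj Y)).i ≫ (r (ι.obj Y)).r) := by
            rw [reassoc_of% map_naturality, F'.map_comp]
        _ = η.app Y := by
            rw [(r (ι.obj Y)).retract, F'.map_id]
            exact Category.comp_id _

end Restriction

section Rep

universe w

variable {k Γ : Type w} [CommRing k] [Group Γ] {X Y Z : Rep.{w} k Γ}

theorem exists_comp_eq_of_range_subset (f : X ⟶ Z) (g : Y ⟶ Z) [Mono g]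
    (h : Set.range f ⊆ Set.range g) : ∃ l : X ⟶ Y, l ≫ g = f := by
  refine ⟨Abelian.monoLift g f ?_, Abelian.monoLift_comp _ _ _⟩
  refine ConcreteCategory.hom_ext _ _ fun x => ?_
  obtain ⟨y, hy⟩ := h ⟨x, rfl⟩
  rw [ConcreteCategory.comp_apply, ← hy]
  exact ConcreteCategory.congr_hom (cokernel.condition g) y

theorem nonempty_iso_of_range_eq (f : X ⟶ Z) (g : Y ⟶ Z) [Mono f] [Mono g]
    (h : Set.range f = Set.range g) : Nonempty (X ≅ Y) := by
  obtain ⟨l, hl⟩ := exists_comp_eq_of_range_subset f g h.subset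
  obtain ⟨m, hm⟩ := exists_comp_eq_of_range_subset g f h.superset
  exact ⟨l, m, by simp [← cancel_mono f, hm, hl], by simp [← cancel_mono g, hl, hm]⟩

theorem exists_comp_eq_of_ker_le (f : X ⟶ Y) (g : X ⟶ Z) [Epi f]
    (h : ∀ x, f x = 0 → g x = 0) : ∃ l : Y ⟶ Z, f ≫ l = g := by
  refine ⟨Abelian.epiDesc f g ?_, Abelian.comp_epiDesc _ _ _⟩
  refine ConcreteCategory.hom_ext _ _ fun x => ?_
  exact h _ (ConcreteCategory.congr_hom (kernel.condition f) x)

theorem nonempty_iso_of_ker_eq (f : X ⟶ Y) (g : X ⟶ Z) [Epi f] [Epi g]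
    (h : ∀ x, f x = 0 ↔ g x = 0) : Nonempty (Y ≅ Z) := by
  obtain ⟨l, hl⟩ := exists_comp_eq_of_ker_le f g fun x => (h x).1
  obtain ⟨m, hm⟩ := exists_comp_eq_of_ker_le g f fun x => (h x).2
  exact ⟨l, m, by simp [← cancel_epi f, reassoc_of% hl, hm],
    by simp [← cancel_epi g, reassoc_of% hm, hl]⟩

end Rep

end Category

section Monoidal

open Functor.LaxMonoidal Functor.OplaxMonoidal

variable {C D : Type*} [Category C] [Category D] [MonoidalCategory C] [MonoidalCategory D]

/-- The lift of a monoidal functor to a full monoidal subcategory is monoidal. -/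
abbrev liftMonoidal (P : ObjectProperty D) [P.IsMonoidal] (K : C ⥤ D) [K.Monoidal]
    (h : ∀ X, P (K.obj X)) : (P.lift K h).Monoidal where
  ε := ObjectProperty.homMk (ε K)
  μ X Y := ObjectProperty.homMk (μ K X Y)
  μ_natural_left f X := P.ι.map_injective (μ_natural_left K f X)
  μ_natural_right X f := P.ι.map_injective (μ_natural_right K X f)
  associativity X Y Z := P.ι.map_injective (Functor.LaxMonoidal.associativity K X Y Z)
  left_unitality X := P.ι.map_injective (Functor.LaxMonoidal.left_unitality K X)
  right_unitality X := P.ι.map_injective (Functor.LaxMonoidal.right_unitality K X)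
  η := ObjectProperty.homMk (η K)
  δ X Y := ObjectProperty.homMk (δ K X Y)
  δ_natural_left f X := P.ι.map_injective (δ_natural_left K f X)
  δ_natural_right X f := P.ι.map_injective (δ_natural_right K X f)
  oplax_associativity X Y Z := P.ι.map_injective (oplax_associativity K X Y Z)
  oplax_left_unitality X := P.ι.map_injective (oplax_left_unitality K X)
  oplax_right_unitality X := P.ι.map_injective (oplax_right_unitality K X)
  ε_η := P.ι.map_injective (Functor.Monoidal.ε_η K)
  η_ε := P.ι.map_injective (Functor.Monoidal.η_ε K)
  μ_δ X Y := P.ι.map_injective (Functor.Monoidal.μ_δ K X Y)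
  δ_μ X Y := P.ι.map_injective (Functor.Monoidal.δ_μ K X Y)

theorem toAdjunction_isMonoidal (e : C ≌ D) [e.functor.Monoidal] :
    letI := e.inverseMonoidal
    e.toAdjunction.IsMonoidal :=
  letI := e.inverseMonoidal
  { leftAdjoint_ε := rfl
    leftAdjoint_μ := fun _ _ => rfl }

variable [BraidedCategory C] [BraidedCategory D]

/-- The lift of a braided functor to a full monoidal subcategory is braided. -/
abbrev liftBraided (P : ObjectProperty D) [P.IsMonoidal] (K : C ⥤ D) [K.Braided]
    (h : ∀ X, P (K.obj X)) : (P.lift K h).Braided where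
  toMonoidal := liftMonoidal P K h
  braided X Y := P.ι.map_injective (Functor.LaxBraided.braided (F := K) X Y)

theorem rightAdjoint_braided {L : C ⥤ D} {R : D ⥤ C} (adj : L ⊣ R) [L.Braided] [R.LaxMonoidal]
    [adj.IsMonoidal] (X Y : D) :
    μ R X Y ≫ R.map (β_ X Y).hom = (β_ (R.obj X) (R.obj Y)).hom ≫ μ R Y X := by
  refine (adj.homEquiv _ _).symm.injective ?_
  simp [Adjunction.homEquiv_counit, Adjunction.map_μ_comp_counit_app_tensor,
    reassoc_of% Adjunction.map_μ_comp_counit_app_tensor]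

/-- The inverse of a braided equivalence is braided. -/
abbrev inverseBraided (e : C ≌ D) [e.functor.Braided] : e.inverse.Braided where
  toMonoidal := e.inverseMonoidal
  braided := by
    let := e.inverseMonoidal
    have := toAdjunction_isMonoidal e
    exact rightAdjoint_braided e.toAdjunction

end Monoidal

section Values

variable {n : ℕ}

theorem stdHom_congr {a b : Fin n → ℕ} {A B : VInf n →ₗ[ℂ] VInf n}
    (hA : PreservesFlag A) (hB : PreservesFlag B) (hA' : ∀ x ∈ stdSub a, A x ∈ stdSub b)
    (hB' : ∀ x ∈ stdSub a, B x ∈ stdSub b) (hAB : ∀ x ∈ stdSub a, A x = B x) :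
    stdHom A hA hA' = stdHom B hB hB' :=
  FlagCat.Hom.ext (LinearMap.ext fun x => Subtype.ext (hAB x.1 x.2))

theorem diagLin_apply_of_mem {a : Fin n → ℕ} (k : ℕ) (t : ℂ) {x : VInf n} (hx : x ∈ stdSub a) :
    diagLin a k t x = x :=
  linMap_eqOn_stdSub (B := LinearMap.id)
    (fun p hp => by rw [diagLin_single, if_pos hp, one_smul, LinearMap.id_apply]) x hx

theorem diagLin_zero_mem {a : Fin n → ℕ} {k : ℕ} {x : VInf n} (hx : x ∈ stdSub (cst n k)) :
    diagLin a k 0 x ∈ stdSub a := by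
  refine stdSub_induction (W := (stdSub a).comap (diagLin a k 0)) (fun p hp => ?_) hx
  rw [Submodule.mem_comap, diagLin_single]
  split_ifs with hpa
  · exact Submodule.smul_mem _ _ (single_mem_stdSub hpa 1)
  · rw [zero_smul]
    exact zero_mem _

/-- The projection `ℂ^{(kⁿ)} ⟶ ℂ^a` that kills the basis vectors outside `ℂ^a`. -/
def trunc (a : Fin n → ℕ) (k : ℕ) : stdFlag (cst n k) ⟶ stdFlag a :=
  stdHom (diagLin a k 0) (diagLin_flag a k 0) fun _ => diagLin_zero_mem

theorem stdIncl_trunc {a : Fin n → ℕ} {k : ℕ} (h : a ≤ cst n k) :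
    stdIncl h ≫ trunc a k = 𝟙 (stdFlag a) := by
  rw [stdIncl, trunc, stdHom_comp]
  exact stdHom_congr _ PreservesFlag.id _ (fun _ hx => hx) fun _ => diagLin_apply_of_mem k 0

variable {F F' : FlagFunctor n} {U V : FlagCat n}

theorem mapLin_id (x : (F.obj U).obj) : mapLin F (𝟙 U) x = x := by
  simp [mapLin]

theorem mapLin_injective {s : U ⟶ V} {r : V ⟶ U} (h : s ≫ r = 𝟙 U) :
    Function.Injective (mapLin F s) :=
  Function.LeftInverse.injective (g := mapLin F r) fun x => by rw [mapLin_comp, h, mapLin_id]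

theorem mapLin_natural (η : F ⟶ F') (f : U ⟶ V) (x : (F.obj U).obj) :
    (η.app V).hom.hom (mapLin F f x) = mapLin F' f ((η.app U).hom.hom x) :=
  congrArg (fun φ => φ.hom.hom x) (η.naturality f)

theorem natTrans_app_injective (η : F ⟶ F') [Mono η] (U : FlagCat n) :
    Function.Injective (η.app U).hom.hom :=
  (fg_mono_iff _).1 ((NatTrans.mono_iff_mono_app η).1 inferInstance U)

theorem natTrans_app_surjective (η : F ⟶ F') [Epi η] (U : FlagCat n) :
    Function.Surjective (η.app U).hom.hom :=
  (fg_epi_iff _).1 ((NatTrans.epi_iff_epi_app η).1 inferInstance U)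

end Values

section Limit

variable {n : ℕ} {F F' : FlagFunctor n} {X : Rep.{0} ℂ (G n)}

theorem exists_limOf (z : LimSpace F) : ∃ j x, limOf F j x = z :=
  Module.DirectLimit.exists_of z

theorem exists_limOf_of_le (z : LimSpace F) (i : ℕ) : ∃ j x, i ≤ j ∧ limOf F j x = z := by
  obtain ⟨j, x, rfl⟩ := exists_limOf z
  exact ⟨max i j, _, le_max_left i j,
    limOf_incl F (fun _ => le_max_right i j) (le_max_right i j) x⟩

theorem limOf_injective (F : FlagFunctor n) (j : ℕ) : Function.Injective (limOf F j) := by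
  rw [injective_iff_map_eq_zero]
  intro x hx
  have : DirectedSystem (fun j : ℕ => stdVal F (cst n j))
      (fun _ _ h => mapLin F (stdIncl fun _ => h)) :=
    ⟨fun _ => mapLin_id, fun _ _ _ _ _ => mapLin_comp F _ _⟩
  obtain ⟨k, hjk, hk⟩ := Module.DirectLimit.of.zero_exact hx
  exact (map_eq_zero_iff _ (mapLin_injective (stdIncl_trunc fun _ => hjk))).1 hk

theorem lim_hom_ext {f g : (limFunctor n).obj F ⟶ X}
    (h : ∀ j (x : stdVal F (cst n j)), f.hom (limOf F j x) = g.hom (limOf F j x)) : f = g := by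
  refine ConcreteCategory.hom_ext _ _ fun z => ?_
  obtain ⟨j, x, rfl⟩ := exists_limOf z
  exact h j x

theorem limFunctor_map_limOf (η : F ⟶ F') (j : ℕ) (x : stdVal F (cst n j)) :
    ((limFunctor n).map η).hom (limOf F j x) =
      limOf F' j ((η.app (stdFlag (cst n j))).hom.hom x) :=
  limMap_of η j x

variable (φ : ∀ j, stdVal F (cst n j) →ₗ[ℂ] X)

/-- Compatibility of a family of linear maps on the spaces `F(ℂ^{(jⁿ)})` with the action of the
group; for `1 : G n` this is the cocone condition. -/
def IsEquivariantCocone : Prop :=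
  ∀ (g : G n) (j k : ℕ) (h : ∀ x ∈ stdSub (cst n j), toEnd g x ∈ stdSub (cst n k))
    (x : stdVal F (cst n j)),
    φ k (mapLin F (stdHom (toEnd g) (preservesFlag_toEnd g) h) x) = X.ρ g (φ j x)

variable {φ}

theorem IsEquivariantCocone.stdIncl (hφ : IsEquivariantCocone φ) (j k : ℕ) (hjk : j ≤ k)
    (x : stdVal F (cst n j)) : φ k (mapLin F (stdIncl fun _ => hjk) x) = φ j x :=
  (hφ 1 j k (stdSub_mono fun _ => hjk) x).trans (by rw [map_one, Module.End.one_apply])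

/-- The underlying linear map of `limDesc`. -/
def limDescLin (hφ : IsEquivariantCocone φ) : LimSpace F →ₗ[ℂ] X :=
  Module.DirectLimit.lift ℂ ℕ _ _ φ hφ.stdIncl

theorem limDescLin_limOf (hφ : IsEquivariantCocone φ) (j : ℕ) (x : stdVal F (cst n j)) :
    limDescLin hφ (limOf F j x) = φ j x :=
  Module.DirectLimit.lift_of _ _ _

/-- The morphism out of the direct limit that is given by an equivariant cocone. -/
def limDesc (hφ : IsEquivariantCocone φ) : (limFunctor n).obj F ⟶ X :=
  Rep.ofHom
    { toLinearMap := limDescLin hφ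
      isIntertwining' := fun g => by
        refine LinearMap.ext fun z => ?_
        obtain ⟨j, x, rfl⟩ := exists_limOf z
        obtain ⟨l, hl⟩ := exists_level g
        have hg := hl.maps (le_max_left j l) (le_max_right j l)
        change limDescLin hφ (limAct F g (limOf F j x)) = X.ρ g (limDescLin hφ (limOf F j x))
        rw [limAct_of F g hg, limDescLin_limOf, limDescLin_limOf, hφ] }

variable {hφ : IsEquivariantCocone φ}

theorem limDesc_limOf (j : ℕ) (x : stdVal F (cst n j)) :
    (limDesc hφ).hom (limOf F j x) = φ j x :=
  limDescLin_limOf hφ j x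

theorem isIso_limDesc (hinj : ∀ j, Function.Injective (φ j))
    (hsurj : ⨆ j, LinearMap.range (φ j) = ⊤) : IsIso (limDesc hφ) := by
  rw [ConcreteCategory.isIso_iff_bijective]
  constructor
  · refine (injective_iff_map_eq_zero (limDesc hφ).hom.toLinearMap).2 fun z hz => ?_
    obtain ⟨j, x, rfl⟩ := exists_limOf z
    rw [(map_eq_zero_iff _ (hinj j)).1 ((limDesc_limOf j x).symm.trans hz)]
    exact map_zero (limOf F j)
  · have range_eq_top : LinearMap.range (limDesc hφ).hom.toLinearMap = ⊤ := top_unique ?_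
    · exact LinearMap.range_eq_top.1 range_eq_top
    rw [← hsurj, iSup_le_iff]
    rintro j _ ⟨x, rfl⟩
    exact ⟨limOf F j x, limDesc_limOf j x⟩

instance : (limFunctor n).Additive where
  map_add {F F'} η θ := lim_hom_ext fun j x => by
    change _ = ((limFunctor n).map η).hom (limOf F j x) + ((limFunctor n).map θ).hom (limOf F j x)
    simp only [limFunctor_map_limOf]
    exact map_add (limOf F' j) _ _

instance : (limFunctor n).Linear ℂ where
  map_smul {F F'} η c := lim_hom_ext fun j x => by
    change _ = c • ((limFunctor n).map η).hom (limOf F j x)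
    simp only [limFunctor_map_limOf]
    exact map_smul (limOf F' j) c _

instance : (limFunctor n).PreservesMonomorphisms where
  preserves {F F'} η _ := by
    rw [Rep.mono_iff_injective]
    refine (injective_iff_map_eq_zero ((limFunctor n).map η).hom.toLinearMap).2 fun z hz => ?_
    obtain ⟨j, x, rfl⟩ := exists_limOf z
    have hx := (map_eq_zero_iff _ (limOf_injective F' j)).1
      ((limFunctor_map_limOf η j x).symm.trans hz)
    rw [(map_eq_zero_iff _ (natTrans_app_injective η _)).1 hx]
    exact map_zero (limOf F j)

instance : (limFunctor n).PreservesEpimorphisms where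
  preserves {F F'} η _ := by
    rw [Rep.epi_iff_surjective]
    intro z
    obtain ⟨j, x, rfl⟩ := exists_limOf z
    obtain ⟨y, rfl⟩ := natTrans_app_surjective η _ x
    exact ⟨limOf F j y, limFunctor_map_limOf η j y⟩

end Limit

section Tensor

variable {n : ℕ}

/-- The pure tensor `x ⊗ y` as an element of `(F ⊗ F')(U)`, which is definitionally the tensor
product of `F(U)` and `F'(U)`. -/
def valTmul {F F' : FlagFunctor n} {U : FlagCat n} (x : (F.obj U).obj) (y : (F'.obj U).obj) :
    ((F ⊗ F').obj U).obj :=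
  TensorProduct.tmul ℂ x y

theorem isEquivariantCocone_tensor (F F' : FlagFunctor n) :
    IsEquivariantCocone (F := F ⊗ F') (X := (limFunctor n).obj F ⊗ (limFunctor n).obj F')
      fun j => TensorProduct.map (limOf F j) (limOf F' j) := fun g j k h x => by
  have map_comp_eq : TensorProduct.map (limOf F k) (limOf F' k) ∘ₗ
      TensorProduct.map (mapLin F (stdHom (toEnd g) (preservesFlag_toEnd g) h))
        (mapLin F' (stdHom (toEnd g) (preservesFlag_toEnd g) h)) =
      TensorProduct.map (limAct F g) (limAct F' g) ∘ₗ
        TensorProduct.map (limOf F j) (limOf F' j) :=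
    TensorProduct.ext' fun x y => by
      simp only [LinearMap.comp_apply, TensorProduct.map_tmul, limAct_of _ g h]
  exact LinearMap.congr_fun map_comp_eq x

/-- The underlying linear map of `limDelta`. -/
def limDeltaLin (F F' : FlagFunctor n) :
    LimSpace (F ⊗ F') →ₗ[ℂ] TensorProduct ℂ (LimSpace F) (LimSpace F') :=
  limDescLin (isEquivariantCocone_tensor F F')

/-- The comparison morphism from the limit of a tensor product to the tensor product of the
limits. -/
def limDelta (F F' : FlagFunctor n) :
    (limFunctor n).obj (F ⊗ F') ⟶ (limFunctor n).obj F ⊗ (limFunctor n).obj F' :=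
  limDesc (isEquivariantCocone_tensor F F')

theorem limDeltaLin_tmul {F F' : FlagFunctor n} {j : ℕ} (x : stdVal F (cst n j))
    (y : stdVal F' (cst n j)) :
    limDeltaLin F F' (limOf (F ⊗ F') j (valTmul x y)) =
      TensorProduct.tmul ℂ (limOf F j x) (limOf F' j y) :=
  (limDescLin_limOf _ j _).trans (TensorProduct.map_tmul _ _ _ _)

theorem iSup_range_map_limOf (F F' : FlagFunctor n) :
    ⨆ j, LinearMap.range (TensorProduct.map (limOf F j) (limOf F' j)) = ⊤ := by
  rw [eq_top_iff, ← TensorProduct.span_tmul_eq_top, Submodule.span_le]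
  rintro _ ⟨x, y, rfl⟩
  obtain ⟨j, x, rfl⟩ := exists_limOf x
  obtain ⟨k, y, hjk, rfl⟩ := exists_limOf_of_le y j
  refine Submodule.mem_iSup_of_mem k
    ⟨TensorProduct.tmul ℂ (mapLin F (stdIncl fun _ => hjk) x) y, ?_⟩
  rw [TensorProduct.map_tmul, limOf_incl _ _ hjk]

instance (F F' : FlagFunctor n) : IsIso (limDelta F F') :=
  isIso_limDesc (fun j => TensorProduct.map_injective_of_flat_flat _ _
    (limOf_injective F j) (limOf_injective F' j)) (iSup_range_map_limOf F F')

theorem isEquivariantCocone_unit : IsEquivariantCocone (F := 𝟙_ (FlagFunctor n))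
    (X := 𝟙_ (Rep.{0} ℂ (G n))) fun _ => (LinearMap.id : ℂ →ₗ[ℂ] ℂ) :=
  fun _ _ _ _ _ => rfl

/-- The underlying linear map of `limEta`. -/
def limEtaLin (n : ℕ) : LimSpace (𝟙_ (FlagFunctor n)) →ₗ[ℂ] ℂ :=
  limDescLin isEquivariantCocone_unit

/-- The comparison morphism from the limit of the unit functor to the unit. -/
def limEta (n : ℕ) : (limFunctor n).obj (𝟙_ (FlagFunctor n)) ⟶ 𝟙_ (Rep.{0} ℂ (G n)) :=
  limDesc isEquivariantCocone_unit

theorem limEtaLin_limOf (j : ℕ) (x : ℂ) : limEtaLin n (limOf (𝟙_ (FlagFunctor n)) j x) = x :=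
  limDescLin_limOf isEquivariantCocone_unit j x

instance : IsIso (limEta n) :=
  isIso_limDesc (fun _ => Function.injective_id)
    (top_unique fun x _ => Submodule.mem_iSup_of_mem 0 ⟨x, rfl⟩)

theorem lim_hom_ext_tensor {F F' : FlagFunctor n} {X : Rep.{0} ℂ (G n)}
    {f g : (limFunctor n).obj (F ⊗ F') ⟶ X}
    (h : ∀ j (x : stdVal F (cst n j)) (y : stdVal F' (cst n j)),
      f.hom (limOf (F ⊗ F') j (valTmul x y)) = g.hom (limOf (F ⊗ F') j (valTmul x y))) :
    f = g := by
  refine lim_hom_ext fun j x => ?_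
  have : f.hom.toLinearMap ∘ₗ limOf (F ⊗ F') j = g.hom.toLinearMap ∘ₗ limOf (F ⊗ F') j :=
    TensorProduct.ext' fun x y => h j x y
  exact LinearMap.congr_fun this x

theorem lim_hom_ext_tensor₃ {F F' F'' : FlagFunctor n} {X : Rep.{0} ℂ (G n)}
    {f g : (limFunctor n).obj ((F ⊗ F') ⊗ F'') ⟶ X}
    (h : ∀ j (x : stdVal F (cst n j)) (y : stdVal F' (cst n j)) (z : stdVal F'' (cst n j)),
      f.hom (limOf ((F ⊗ F') ⊗ F'') j (valTmul (F := F ⊗ F') (valTmul x y) z)) =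
        g.hom (limOf ((F ⊗ F') ⊗ F'') j (valTmul (F := F ⊗ F') (valTmul x y) z))) :
    f = g := by
  refine lim_hom_ext fun j x => ?_
  have : f.hom.toLinearMap ∘ₗ limOf ((F ⊗ F') ⊗ F'') j =
      g.hom.toLinearMap ∘ₗ limOf ((F ⊗ F') ⊗ F'') j :=
    TensorProduct.ext_threefold fun x y z => h j x y z
  exact LinearMap.congr_fun this x

theorem limDelta_naturality {F₁ F₂ F₁' F₂' : FlagFunctor n} (f : F₁ ⟶ F₂) (f' : F₁' ⟶ F₂') :
    limDelta F₁ F₁' ≫ ((limFunctor n).map f ⊗ₘ (limFunctor n).map f') =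
      (limFunctor n).map (f ⊗ₘ f') ≫ limDelta F₂ F₂' := lim_hom_ext_tensor fun j x y => by
  change TensorProduct.map (limMap f) (limMap f')
      (limDeltaLin F₁ F₁' (limOf (F₁ ⊗ F₁') j (valTmul x y))) =
    limDeltaLin F₂ F₂' (limMap (f ⊗ₘ f') (limOf (F₁ ⊗ F₁') j (valTmul x y)))
  rw [limDeltaLin_tmul, limMap_of, TensorProduct.map_tmul, limMap_of, limMap_of]
  exact (limDeltaLin_tmul _ _).symm

theorem limDelta_associativity (F F' F'' : FlagFunctor n) :
    limDelta (F ⊗ F') F'' ≫ limDelta F F' ▷ _ ≫ (α_ _ _ _).hom =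
      (limFunctor n).map (α_ F F' F'').hom ≫ limDelta F (F' ⊗ F'') ≫ _ ◁ limDelta F' F'' :=
  lim_hom_ext_tensor₃ fun j x y z => by
    change TensorProduct.assoc ℂ (LimSpace F) (LimSpace F') (LimSpace F'')
        (TensorProduct.map (limDeltaLin F F') (LinearMap.id (M := LimSpace F''))
          (limDeltaLin (F ⊗ F') F''
            (limOf ((F ⊗ F') ⊗ F'') j (valTmul (F := F ⊗ F') (valTmul x y) z)))) =
      TensorProduct.map (LinearMap.id (M := LimSpace F)) (limDeltaLin F' F'')
        (limDeltaLin F (F' ⊗ F'') (limMap (α_ F F' F'').hom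
          (limOf ((F ⊗ F') ⊗ F'') j (valTmul (F := F ⊗ F') (valTmul x y) z))))
    rw [limDeltaLin_tmul, limMap_of, TensorProduct.map_tmul, limDeltaLin_tmul]
    refine Eq.trans ?_ (congrArg _
      (limDeltaLin_tmul (F' := F' ⊗ F'') x (valTmul y z)).symm)
    rw [TensorProduct.map_tmul, limDeltaLin_tmul]
    rfl

theorem limDelta_left_unitality (F : FlagFunctor n) :
    (λ_ ((limFunctor n).obj F)).inv =
      (limFunctor n).map (λ_ F).inv ≫ limDelta (𝟙_ _) F ≫ limEta n ▷ _ :=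
  lim_hom_ext fun j x => by
    change (TensorProduct.lid ℂ (LimSpace F)).symm (limOf F j x) =
      TensorProduct.map (limEtaLin n) (LinearMap.id (M := LimSpace F))
        (limDeltaLin (𝟙_ _) F (limMap (λ_ F).inv (limOf F j x)))
    rw [limMap_of]
    refine Eq.trans ?_ (congrArg _
      (limDeltaLin_tmul (F := 𝟙_ (FlagFunctor n)) (1 : ℂ) x).symm)
    rw [TensorProduct.map_tmul, limEtaLin_limOf]
    rfl

theorem limDelta_right_unitality (F : FlagFunctor n) :
    (ρ_ ((limFunctor n).obj F)).inv =
      (limFunctor n).map (ρ_ F).inv ≫ limDelta F (𝟙_ _) ≫ _ ◁ limEta n :=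
  lim_hom_ext fun j x => by
    change (TensorProduct.rid ℂ (LimSpace F)).symm (limOf F j x) =
      TensorProduct.map (LinearMap.id (M := LimSpace F)) (limEtaLin n)
        (limDeltaLin F (𝟙_ _) (limMap (ρ_ F).inv (limOf F j x)))
    rw [limMap_of]
    refine Eq.trans ?_ (congrArg _
      (limDeltaLin_tmul (F' := 𝟙_ (FlagFunctor n)) x (1 : ℂ)).symm)
    rw [TensorProduct.map_tmul, limEtaLin_limOf]
    rfl

theorem limDelta_braiding (F F' : FlagFunctor n) :
    limDelta F F' ≫ (β_ ((limFunctor n).obj F) ((limFunctor n).obj F')).hom =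
      (limFunctor n).map (β_ F F').hom ≫ limDelta F' F := lim_hom_ext_tensor fun j x y => by
  change TensorProduct.comm ℂ (LimSpace F) (LimSpace F')
      (limDeltaLin F F' (limOf (F ⊗ F') j (valTmul x y))) =
    limDeltaLin F' F (limMap (β_ F F').hom (limOf (F ⊗ F') j (valTmul x y)))
  rw [limDeltaLin_tmul, limMap_of]
  exact (limDeltaLin_tmul y x).symm

instance : (limFunctor n).OplaxMonoidal where
  η := limEta n
  δ := limDelta
  δ_natural_left f F := by simpa using limDelta_naturality f (𝟙 F)
  δ_natural_right F f := by simpa using limDelta_naturality (𝟙 F) f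
  oplax_associativity := limDelta_associativity
  oplax_left_unitality := limDelta_left_unitality
  oplax_right_unitality := limDelta_right_unitality

instance : IsIso (Functor.OplaxMonoidal.η (limFunctor n)) :=
  inferInstanceAs (IsIso (limEta n))

instance (F F' : FlagFunctor n) : IsIso (Functor.OplaxMonoidal.δ (limFunctor n) F F') :=
  inferInstanceAs (IsIso (limDelta F F'))

instance : (limFunctor n).Monoidal := Functor.Monoidal.ofOplaxMonoidal _

theorem limDelta_mu (F F' : FlagFunctor n) :
    limDelta F F' ≫ Functor.LaxMonoidal.μ (limFunctor n) F F' = 𝟙 _ :=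
  Functor.Monoidal.δ_μ (limFunctor n) F F'

instance : (limFunctor n).Braided where
  braided F F' := by
    rw [← cancel_epi (limDelta F F'), reassoc_of% limDelta_mu, reassoc_of% limDelta_braiding,
      limDelta_mu, Category.comp_id]

theorem lim_mu_tmul {F F' : FlagFunctor n} {j : ℕ} (x : stdVal F (cst n j))
    (y : stdVal F' (cst n j)) :
    (Functor.LaxMonoidal.μ (limFunctor n) F F').hom
      (TensorProduct.tmul ℂ (limOf F j x) (limOf F' j y)) = limOf (F ⊗ F') j (valTmul x y) :=
  (congrArg (Functor.LaxMonoidal.μ (limFunctor n) F F').hom (limDeltaLin_tmul x y).symm).trans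
    (ConcreteCategory.congr_hom (limDelta_mu F F') (limOf (F ⊗ F') j (valTmul x y)))

theorem lim_epsilon_one (j : ℕ) : (Functor.LaxMonoidal.ε (limFunctor n)).hom (1 : ℂ) =
    limOf (𝟙_ (FlagFunctor n)) j (1 : ℂ) :=
  (congrArg (Functor.LaxMonoidal.ε (limFunctor n)).hom (limEtaLin_limOf j 1).symm).trans
    (ConcreteCategory.congr_hom (Functor.Monoidal.η_ε (limFunctor n))
      (limOf (𝟙_ (FlagFunctor n)) j (1 : ℂ)))

theorem isEquivariantCocone_subtype : IsEquivariantCocone (F := flagForget n) (X := stdRep n)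
    fun j => (stdSub (cst n j)).subtype :=
  fun _ _ _ _ _ => rfl

/-- The comparison morphism from the limit of the forgetful functor to the standard
representation. -/
def limForget (n : ℕ) : (limFunctor n).obj (flagForget n) ⟶ stdRep n :=
  limDesc isEquivariantCocone_subtype

instance : IsIso (limForget n) :=
  isIso_limDesc (fun _ => Subtype.val_injective) (top_unique fun x _ => by
    obtain ⟨j, hj⟩ := exists_mem_stdSub x
    exact Submodule.mem_iSup_of_mem j ⟨⟨x, hj⟩, rfl⟩)

theorem isPolyRep_lim (F : PolyFunctor n) : isPolyRep n ((limFunctor n).obj F.obj) :=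
  isPolynomial_map (limFunctor n) (asIso (limForget n)) F.property

end Tensor

/-- `F` is polynomial on morphisms: each vector `x ∈ F(U)` is moved by the morphisms `f : U ⟶ V`
through a polynomial map in the underlying linear map of `f`. -/
def IsPolyOnHoms {n : ℕ} (F : FlagFunctor n) : Prop :=
  ∀ (U V : FlagCat n) (x : (F.obj U).obj),
    ∃ p : (U.carrier →ₗ[ℂ] V.carrier) → (F.obj V).obj, IsPolyMap p ∧
      ∀ f : U ⟶ V, mapLin F f x = p f.toLin

namespace IsPolyOnHoms

variable {n : ℕ} {F F' : FlagFunctor n}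

theorem of_mono (η : F ⟶ F') [Mono η] (h : IsPolyOnHoms F') : IsPolyOnHoms F := fun U V x => by
  obtain ⟨p, hp, hpf⟩ := h U V ((η.app U).hom.hom x)
  obtain ⟨r, hr⟩ := LinearMap.exists_leftInverse_of_injective (η.app V).hom.hom
    (LinearMap.ker_eq_bot.2 (natTrans_app_injective η V))
  refine ⟨fun f => r (p f), hp.map r, fun f => ?_⟩
  change _ = r (p f.toLin)
  rw [← hpf f, ← mapLin_natural]
  exact (LinearMap.congr_fun hr _).symm

theorem of_epi (η : F ⟶ F') [Epi η] (h : IsPolyOnHoms F) : IsPolyOnHoms F' := fun U V y => by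
  obtain ⟨x, rfl⟩ := natTrans_app_surjective η U y
  obtain ⟨p, hp, hpf⟩ := h U V x
  exact ⟨_, hp.map (η.app V).hom.hom, fun f => by rw [← hpf f, mapLin_natural]⟩

theorem unit : IsPolyOnHoms (𝟙_ (FlagFunctor n)) := fun _ _ x =>
  ⟨_, IsPolyMap.const x, fun _ => rfl⟩

theorem tensor (h : IsPolyOnHoms F) (h' : IsPolyOnHoms F') : IsPolyOnHoms (F ⊗ F') := by
  intro U V (z : TensorProduct ℂ (F.obj U).obj (F'.obj U).obj)
  suffices ∃ p : (U.carrier →ₗ[ℂ] V.carrier) → TensorProduct ℂ (F.obj V).obj (F'.obj V).obj,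
      IsPolyMap p ∧ ∀ f : U ⟶ V, TensorProduct.map (mapLin F f) (mapLin F' f) z = p f.toLin from
    this
  induction z using TensorProduct.induction_on with
  | zero => exact ⟨_, IsPolyMap.const 0, fun _ => map_zero _⟩
  | tmul x y =>
    obtain ⟨p, hp, hpf⟩ := h U V x
    obtain ⟨q, hq, hqf⟩ := h' U V y
    exact ⟨_, hp.tmul hq, fun f => by rw [TensorProduct.map_tmul, hpf, hqf]⟩
  | add x y hx hy =>
    obtain ⟨p, hp, hpf⟩ := hx
    obtain ⟨q, hq, hqf⟩ := hy
    exact ⟨_, hp.add hq, fun f => by rw [map_add, hpf, hqf, Pi.add_apply]⟩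

theorem tensorPow (h : IsPolyOnHoms F) : ∀ k, IsPolyOnHoms (tensorPow F k)
  | 0 => unit
  | k + 1 => (tensorPow h k).tensor h

theorem forget : IsPolyOnHoms (flagForget n) := fun U V (x : U.carrier) => by
  let b := Module.finBasis ℂ V.carrier
  refine ⟨∑ i, fun f => b.coord i (f x) • b i, IsPolyMap.sum _ fun i _ =>
    IsPolyMap.linear (b.coord i ∘ₗ LinearMap.applyₗ x) (b i), fun f => ?_⟩
  exact (b.sum_repr (f.toLin x)).symm.trans
    (Finset.sum_apply (M := fun _ => V.carrier) f.toLin Finset.univ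
      fun i f => b.coord i (f x) • b i).symm

open Limits in
theorem biproduct {k : ℕ} {X : Fin k → FlagFunctor n} (h : ∀ i, IsPolyOnHoms (X i)) :
    IsPolyOnHoms (⨁ X) := fun U V x => by
  choose p hp hpf using fun i => h i U V (((biproduct.π X i).app U).hom.hom x)
  refine ⟨∑ i, fun f => ((biproduct.ι X i).app V).hom.hom (p i f),
    IsPolyMap.sum _ fun i _ => (hp i).map ((biproduct.ι X i).app V).hom.hom, fun f => ?_⟩
  have total (y : ((⨁ X).obj V).obj) :
      ∑ i, ((biproduct.ι X i).app V).hom.hom (((biproduct.π X i).app V).hom.hom y) = y := by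
    let E := (evaluation _ _).obj V ⋙ forget₂ (FGModuleCat ℂ) (ModuleCat ℂ)
    have := congrArg (fun η => (E.map η).hom y) (biproduct.total (f := X))
    simp only [Functor.map_sum, ModuleCat.hom_sum, LinearMap.sum_apply] at this
    exact this
  rw [Finset.sum_apply, ← total (mapLin _ f x)]
  exact Finset.sum_congr rfl fun i _ => by rw [mapLin_natural, hpf]

theorem of_isPolyFunctor (h : isPolyFunctor n F) : IsPolyOnHoms F := by
  obtain ⟨k, a, Z, i, q, _, _⟩ := h
  exact of_epi q (of_mono i (biproduct fun i => tensorPow forget (a i)))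

end IsPolyOnHoms

section Limit

variable {n : ℕ}

/-- The direct limit of a polynomial functor, as a polynomial representation. -/
abbrev limPoly (F : PolyFunctor n) : PolyRep n := ⟨(limFunctor n).obj F.obj, isPolyRep_lim F⟩

/-- The corner of an endomorphism of `ℂ^∞` on `ℂ^a`: its restriction to `ℂ^a` followed by the
projection to `ℂ^a`. -/
def corner (a : Fin n → ℕ) :
    (VInf n →ₗ[ℂ] VInf n) →ₗ[ℂ] (stdFlag a).carrier →ₗ[ℂ] (stdFlag a).carrier where
  toFun A :=
    Finsupp.restrictDom ℂ ℂ {p : Fin n × ℕ | p.2 < a p.1} ∘ₗ A ∘ₗ (stdSub a).subtype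
  map_add' A B := LinearMap.ext fun x => map_add (Finsupp.restrictDom ℂ ℂ _) (A x.1) (B x.1)
  map_smul' c A := LinearMap.ext fun x => map_smul (Finsupp.restrictDom ℂ ℂ _) c (A x.1)

theorem corner_eq_stdHom {a : Fin n → ℕ} {A : VInf n →ₗ[ℂ] VInf n} (hA : PreservesFlag A)
    (h : ∀ x ∈ stdSub a, A x ∈ stdSub a) : corner a A = (stdHom A hA h).toLin :=
  LinearMap.ext fun x => LinearMap.congr_fun
    (Finsupp.restrictDom_comp_subtype (R := ℂ) {p : Fin n × ℕ | p.2 < a p.1}) ⟨A x.1, h x.1 x.2⟩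

theorem endAction_limOf_of_isLevel (F : PolyFunctor n) {j : ℕ} (A : flagEnd n)
    (hA : IsLevel j (A : Module.End ℂ (VInf n))) (x : stdVal F.obj (cst n j)) :
    endAction (limPoly F) A (limOf F.obj j x) =
      limOf F.obj j (mapLin F.obj (stdHom (A : Module.End ℂ (VInf n)) A.2.1 hA.1) x) := by
  obtain ⟨p, hp, hpA⟩ := (endAction_spec (limPoly F)).polynomial j (limOf F.obj j x)
  obtain ⟨q, hq, hqf⟩ := IsPolyOnHoms.of_isPolyFunctor F.property _ _ x
  rw [hqf, ← corner_eq_stdHom]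
  -- Both sides depend polynomially on `A` and agree on the group, which is Zariski dense.
  have hq' := (hq.precomp (E' := VInf n →ₗ[ℂ] VInf n) (corner (cst n j))).map (limOf F.obj j)
  refine (hpA A hA).trans (sub_eq_zero.1
    (poly_vanish (hp.sub hq') (fun g hg => sub_eq_zero.2 ?_) A.2.1 hA))
  have hG : toEnd g ∈ flagEnd n := ⟨preservesFlag_toEnd g, exists_level g⟩
  refine (hpA ⟨toEnd g, hG⟩ hg).symm.trans ((endAction_toEnd _ g _ rfl _).trans ?_)
  exact (limAct_of F.obj g hg.1 x).trans (by rw [hqf, ← corner_eq_stdHom])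

end Limit

section Values

variable {n : ℕ}

theorem le_cst_sup (a : Fin n → ℕ) : a ≤ cst n (Finset.univ.sup a) :=
  fun i => Finset.le_sup (f := a) (Finset.mem_univ i)

/-- The canonical map `F(ℂ^a) → lim F(ℂ^{(jⁿ)})`. -/
def toLim (F : FlagFunctor n) (a : Fin n → ℕ) : stdVal F a →ₗ[ℂ] LimSpace F :=
  limOf F (Finset.univ.sup a) ∘ₗ mapLin F (stdIncl (le_cst_sup a))

theorem toLim_eq {F : FlagFunctor n} {a : Fin n → ℕ} {k : ℕ} (h : a ≤ cst n k) (x : stdVal F a) :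
    toLim F a x = limOf F k (mapLin F (stdIncl h) x) := by
  have hk : Finset.univ.sup a ≤ k := Finset.sup_le fun i _ => h i
  rw [toLim, LinearMap.comp_apply, ← limOf_incl F (fun _ => hk) hk, mapLin_comp]
  rfl

theorem toLim_cst {F : FlagFunctor n} (j : ℕ) (x : stdVal F (cst n j)) :
    toLim F (cst n j) x = limOf F j x :=
  (toLim_eq le_rfl x).trans (limOf_incl F le_rfl le_rfl x)

theorem toLim_injective (F : FlagFunctor n) (a : Fin n → ℕ) : Function.Injective (toLim F a) :=
  (limOf_injective F _).comp (mapLin_injective (stdIncl_trunc (le_cst_sup a)))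

theorem limMap_toLim {F F' : FlagFunctor n} (η : F ⟶ F') (a : Fin n → ℕ) (x : stdVal F a) :
    limMap η (toLim F a x) = toLim F' a ((η.app (stdFlag a)).hom.hom x) := by
  rw [toLim, LinearMap.comp_apply, limMap_of, mapLin_natural]
  rfl

theorem endAction_toLim (F : PolyFunctor n) (A : flagEnd n) {a b : Fin n → ℕ}
    (h : ∀ x ∈ stdSub a, (A : Module.End ℂ (VInf n)) x ∈ stdSub b) (x : stdVal F.obj a) :
    endAction (limPoly F) A (toLim F.obj a x) =
      toLim F.obj b (mapLin F.obj (stdHom (A : Module.End ℂ (VInf n)) A.2.1 h) x) := by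
  obtain ⟨hA, l, hl⟩ := A.2
  have ha : a ≤ cst n (max (lvl a b) l) := (le_lvl_left a b).trans fun _ => le_max_left _ _
  have hb : b ≤ cst n (max (lvl a b) l) := (le_lvl_right a b).trans fun _ => le_max_left _ _
  have hlevel := hl.mono (le_max_right (lvl a b) l)
  rw [toLim_eq ha, toLim_eq hb]
  refine (endAction_limOf_of_isLevel F A hlevel _).trans ?_
  rw [mapLin_comp, mapLin_comp]
  rfl

theorem toLim_mem_invariants (F : PolyFunctor n) (a : Fin n → ℕ) (x : stdVal F.obj a) :
    toLim F.obj a x ∈ invariants (limPoly F).obj a := by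
  intro g hg
  have hG : toEnd g ∈ flagEnd n := ⟨preservesFlag_toEnd g, exists_level g⟩
  have hmaps : ∀ x ∈ stdSub a, toEnd g x ∈ stdSub a := fun x hx => by rwa [hg.1 x hx]
  have stdHom_eq_id : stdHom (toEnd g) hG.1 hmaps = 𝟙 (stdFlag a) :=
    stdHom_congr _ PreservesFlag.id _ (fun _ hx => hx) hg.1
  refine (endAction_toEnd _ g ⟨toEnd g, hG⟩ rfl _).symm.trans
    ((endAction_toLim F _ hmaps x).trans ?_)
  rw [stdHom_eq_id, mapLin_id]

/-- The canonical map from `F(ℂ^a)` to the invariants of `H_a` on the direct limit. -/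
def toInv (F : PolyFunctor n) (a : Fin n → ℕ) : stdVal F.obj a →ₗ[ℂ] invariants (limPoly F).obj a :=
  (toLim F.obj a).codRestrict (invariants (limPoly F).obj a) (toLim_mem_invariants F a)

theorem toInv_bijective (F : PolyFunctor n) (a : Fin n → ℕ) : Function.Bijective (toInv F a) := by
  refine ⟨fun x y h => toLim_injective F.obj a (congrArg Subtype.val h), fun ⟨z, hz⟩ => ?_⟩
  obtain ⟨k, x, rfl⟩ := exists_limOf z
  let P : flagEnd n := ⟨diagLin a k 0, diagLin_flag a k 0, k, diagLin_level 0⟩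
  have proj_fixes := endAction_proj (limPoly F) k hz P rfl
  rw [← toLim_cst] at proj_fixes
  exact ⟨mapLin F.obj (trunc a k) x, Subtype.ext
    ((endAction_toLim F P (fun _ => diagLin_zero_mem) x).symm.trans
      (proj_fixes.trans (toLim_cst k x)))⟩

theorem endAction_extend_toLim (F : PolyFunctor n) {a b : Fin n → ℕ} (f : stdFlag a ⟶ stdFlag b)
    (x : stdVal F.obj a) :
    endAction (limPoly F) (extend f) (toLim F.obj a x) = toLim F.obj b (mapLin F.obj f x) := by
  have hmaps : ∀ x ∈ stdSub a, (extend f : Module.End ℂ (VInf n)) x ∈ stdSub b := fun x hx =>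
    (extendLin_apply f ⟨x, hx⟩).symm ▸ (stdLin f _).2
  have stdHom_extend : stdHom (extend f : Module.End ℂ (VInf n)) (extend f).2.1 hmaps = f :=
    FlagCat.Hom.ext (LinearMap.ext fun x => Subtype.ext (extendLin_apply f x))
  rw [endAction_toLim F (extend f) hmaps, stdHom_extend]

/-- A polynomial functor is recovered, on the standard flags, from its direct limit: its value at
`ℂ^a` is the space of invariants of `H_a`. -/
def invIso (n : ℕ) : restrictStd n ≅ Phi n isPolyRep_lim ⋙ invFunctor n :=
  NatIso.ofComponents
    (fun F => NatIso.ofComponents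
      (fun a => (LinearEquiv.ofBijective _ (toInv_bijective F a)).toModuleIso)
      fun f => ModuleCat.hom_ext (LinearMap.ext fun x =>
        Subtype.ext (endAction_extend_toLim F f.hom x).symm))
    fun η => NatTrans.ext (funext fun a => ModuleCat.hom_ext (LinearMap.ext fun x =>
      Subtype.ext (limMap_toLim η.hom a x).symm))

end Values

section Retract

variable {n : ℕ}

theorem exists_isProj {K U : Type*} [Field K] [AddCommGroup U] [Module K U]
    (W : Submodule K U) : ∃ e : U →ₗ[K] U, LinearMap.IsProj W e := by
  obtain ⟨p, hp⟩ := W.subtype.exists_leftInverse_of_injective W.ker_subtype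
  exact ⟨W.subtype ∘ₗ p, ⟨fun x => (p x).2, fun x hx =>
    congrArg Subtype.val (LinearMap.congr_fun hp ⟨x, hx⟩)⟩⟩

variable {U : FlagCat n} {e : Fin (n + 1) → U.carrier →ₗ[ℂ] U.carrier}

/-- The difference of the projections onto two successive steps of a flag. The projections need not
commute, so this is in general not a projection. -/
def gradedPart (e : Fin (n + 1) → U.carrier →ₗ[ℂ] U.carrier) (i : Fin n) :
    U.carrier →ₗ[ℂ] U.carrier :=
  e i.succ - e i.castSucc

theorem gradedPart_mem (he : ∀ i, LinearMap.IsProj (U.fil i) (e i)) (i : Fin n) (x : U.carrier) :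
    gradedPart e i x ∈ U.fil i.succ :=
  sub_mem ((he _).map_mem x) (U.mono i.castSucc_le_succ ((he _).map_mem x))

theorem gradedPart_eq_zero (he : ∀ i, LinearMap.IsProj (U.fil i) (e i)) {k : Fin (n + 1)}
    {i : Fin n} (h : k ≤ i.castSucc) {x : U.carrier} (hx : x ∈ U.fil k) : gradedPart e i x = 0 := by
  have hx' := U.mono h hx
  rw [gradedPart, LinearMap.sub_apply, (he _).map_id x (U.mono i.castSucc_le_succ hx'),
    (he _).map_id x hx', sub_self]

theorem sum_gradedPart (he : ∀ i, LinearMap.IsProj (U.fil i) (e i)) (x : U.carrier) :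
    ∑ i, gradedPart e i x = x := by
  have proj_zero : e 0 x = 0 := by
    simpa only [U.fil_zero, Submodule.mem_bot] using (he 0).map_mem x
  have proj_last : e (Fin.last n) x = x :=
    (he _).map_id x (by rw [U.fil_last]; exact Submodule.mem_top)
  have telescope := Fin.sum_univ_succ (fun i => e i x)
  rw [Fin.sum_univ_castSucc, proj_zero, proj_last, zero_add] at telescope
  simp only [gradedPart, LinearMap.sub_apply, Finset.sum_sub_distrib]
  rw [← telescope, add_sub_cancel_left]

variable {d : ℕ} (b : Module.Basis (Fin d) ℂ U.carrier)

/-- The map `U → 𝐕` that spreads the coordinates of the `i`-th graded part of a vector over the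
basis vectors `e_{i,m}`. -/
def flagEmbedLin (e : Fin (n + 1) → U.carrier →ₗ[ℂ] U.carrier) : U.carrier →ₗ[ℂ] VInf n :=
  ∑ i : Fin n, ∑ k : Fin d, Finsupp.lsingle (i, (k : ℕ)) ∘ₗ b.coord k ∘ₗ gradedPart e i

theorem flagEmbedLin_apply (x : U.carrier) : flagEmbedLin b e x =
    ∑ i : Fin n, ∑ k : Fin d, Finsupp.single (i, (k : ℕ)) (b.repr (gradedPart e i x) k) := by
  simp only [flagEmbedLin, LinearMap.sum_apply, LinearMap.comp_apply, Finsupp.lsingle_apply,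
    Module.Basis.coord_apply]

/-- The embedding of a flag into a standard one. -/
def flagEmbed (he : ∀ i, LinearMap.IsProj (U.fil i) (e i)) : U ⟶ stdFlag (cst n d) :=
  FlagCat.Hom.mk (W := stdFlag (cst n d))
    (LinearMap.codRestrict (stdSub (cst n d)) (flagEmbedLin b e) fun x => by
      rw [flagEmbedLin_apply]
      exact sum_mem fun i _ => sum_mem fun k _ => single_mem_stdSub (a := cst n d) k.2 _)
    fun i x hx => by
      change flagEmbedLin b e x ∈ flagSub n i
      rw [flagEmbedLin_apply]
      refine sum_mem fun k _ => sum_mem fun l _ => ?_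
      by_cases hk : (k : ℕ) < i
      · exact single_mem_flagSub hk _
      · rw [gradedPart_eq_zero he (Fin.le_def.2 (not_lt.1 hk)) hx]
        simp

/-- The map `𝐕 → U` that sends `e_{i,m}` to the projection of the `m`-th basis vector of `U` onto
the `i`-th step of the flag. -/
def flagProjLin (e : Fin (n + 1) → U.carrier →ₗ[ℂ] U.carrier) : VInf n →ₗ[ℂ] U.carrier :=
  Finsupp.linearCombination ℂ fun p => if h : p.2 < d then e p.1.succ (b ⟨p.2, h⟩) else 0

theorem flagProjLin_single (i : Fin n) (k : Fin d) (t : ℂ) :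
    flagProjLin b e (Finsupp.single (i, (k : ℕ)) t) = e i.succ (t • b k) := by
  rw [flagProjLin, Finsupp.linearCombination_single, dif_pos k.2, map_smul]

theorem flagProjLin_mem (he : ∀ i, LinearMap.IsProj (U.fil i) (e i)) (i : Fin (n + 1)) {x : VInf n}
    (hx : x ∈ flagSub n i) : flagProjLin b e x ∈ U.fil i := by
  suffices flagSub n i ≤ (U.fil i).comap (flagProjLin b e) from this hx
  rw [flagSub, Finsupp.supported_eq_span_single, Submodule.span_le]
  rintro _ ⟨p, hp, rfl⟩
  rw [SetLike.mem_coe, Submodule.mem_comap, flagProjLin, Finsupp.linearCombination_single, one_smul]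
  split_ifs
  · exact U.mono (Fin.le_def.2 (Nat.succ_le_of_lt hp)) ((he p.1.succ).map_mem _)
  · exact zero_mem _

/-- The projection of a standard flag onto a flag, a retraction of `flagEmbed`. -/
def flagProj (he : ∀ i, LinearMap.IsProj (U.fil i) (e i)) : stdFlag (cst n d) ⟶ U :=
  FlagCat.Hom.mk (V := stdFlag (cst n d)) (flagProjLin b e ∘ₗ (stdSub (cst n d)).subtype)
    fun i _ hx => flagProjLin_mem b he i hx

theorem flagEmbed_flagProj (he : ∀ i, LinearMap.IsProj (U.fil i) (e i)) :
    flagEmbed b he ≫ flagProj b he = 𝟙 U := by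
  refine FlagCat.Hom.ext (LinearMap.ext fun x => ?_)
  change flagProjLin b e (flagEmbedLin b e x) = x
  simp only [flagEmbedLin_apply, map_sum, flagProjLin_single]
  refine Eq.trans (Finset.sum_congr rfl fun i _ => ?_) (sum_gradedPart he x)
  rw [← map_sum, b.sum_repr, (he i.succ).map_id _ (gradedPart_mem he i x)]

theorem exists_retract (U : FlagCat n) :
    ∃ j, Nonempty (Retract U (stdFlag (cst n j))) := by
  choose e he using fun i => exists_isProj (U.fil i)
  exact ⟨_, ⟨⟨_, _, flagEmbed_flagProj (Module.finBasis ℂ U.carrier) he⟩⟩⟩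

end Retract

section Subfunctor

variable {n : ℕ} (P : FlagFunctor n) (W : Submodule ℂ (LimSpace P))

/-- The vectors of `P(U)` all of whose images in the direct limit lie in `W`. -/
def subVal (U : FlagCat n) : Submodule ℂ (P.obj U).obj :=
  ⨅ (j : ℕ) (f : U ⟶ stdFlag (cst n j)), W.comap (limOf P j ∘ₗ mapLin P f)

variable {P W} in
theorem mem_subVal {U : FlagCat n} {x : (P.obj U).obj} :
    x ∈ subVal P W U ↔ ∀ (j : ℕ) (f : U ⟶ stdFlag (cst n j)), limOf P j (mapLin P f x) ∈ W := by
  simp only [subVal, Submodule.mem_iInf, Submodule.mem_comap, LinearMap.comp_apply]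

theorem mapLin_mem_subVal {U V : FlagCat n} (f : U ⟶ V) :
    ∀ x ∈ subVal P W U, mapLin P f x ∈ subVal P W V := by
  intro x hx
  rw [mem_subVal] at hx ⊢
  intro j g
  rw [mapLin_comp]
  exact hx j _

/-- The largest subfunctor of `P` whose direct limit is contained in `W`. -/
def subFunctor : FlagFunctor n where
  obj U := FGModuleCat.of ℂ (subVal P W U)
  map f := FGModuleCat.ofHom ((mapLin P f).restrict (mapLin_mem_subVal P W f))
  map_id _ := ObjectProperty.hom_ext _ (ModuleCat.hom_ext (LinearMap.ext fun x =>
    Subtype.ext (mapLin_id (F := P) x.1)))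
  map_comp f g := ObjectProperty.hom_ext _ (ModuleCat.hom_ext (LinearMap.ext fun x =>
    Subtype.ext (mapLin_comp P f g x.1).symm))

/-- The inclusion of the subfunctor. -/
def subFunctorι : subFunctor P W ⟶ P where
  app U := FGModuleCat.ofHom (subVal P W U).subtype
  naturality _ _ _ := rfl

instance : Mono (subFunctorι P W) :=
  (NatTrans.mono_iff_mono_app _).2 fun U => (fg_mono_iff _).2 (subVal P W U).subtype_injective

/-- The quotient of `P` by the largest subfunctor whose direct limit is contained in `W`. -/
def quotFunctor : FlagFunctor n where
  obj U := FGModuleCat.of ℂ ((P.obj U).obj ⧸ subVal P W U)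
  map f := FGModuleCat.ofHom (Submodule.mapQ _ _ (mapLin P f) (mapLin_mem_subVal P W f))
  map_id _ := ObjectProperty.hom_ext _ (ModuleCat.hom_ext (Submodule.linearMap_qext _
    (LinearMap.ext fun x => congrArg (Submodule.mkQ _) (mapLin_id x))))
  map_comp f g := ObjectProperty.hom_ext _ (ModuleCat.hom_ext (Submodule.linearMap_qext _
    (LinearMap.ext fun x => congrArg (Submodule.mkQ _) (mapLin_comp P f g x).symm)))

/-- The projection to the quotient functor. -/
def quotFunctorπ : P ⟶ quotFunctor P W where
  app _ := FGModuleCat.ofHom (Submodule.mkQ _)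
  naturality _ _ _ := rfl

instance : Epi (quotFunctorπ P W) :=
  (NatTrans.epi_iff_epi_app _).2 fun _ => (fg_epi_iff _).2 (Submodule.mkQ_surjective _)

end Subfunctor

section EssentialImage

open Limits

variable {n : ℕ} {P : PolyFunctor n} {W : Submodule ℂ (LimSpace P.obj)}

theorem mem_subVal_cst (hW : ∀ A : flagEnd n, ∀ z ∈ W, endAction (limPoly P) A z ∈ W) {j : ℕ}
    {x : stdVal P.obj (cst n j)} :
    x ∈ subVal P.obj W (stdFlag (cst n j)) ↔ limOf P.obj j x ∈ W := by
  rw [mem_subVal]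
  refine ⟨fun h => ?_, fun h k f => ?_⟩
  · have h_id := h j (𝟙 _)
    rwa [mapLin_id] at h_id
  · have h_act := hW (extend f) _ h
    rwa [← toLim_cst, endAction_extend_toLim, toLim_cst] at h_act

theorem range_map_subFunctorι (hW : ∀ A : flagEnd n, ∀ z ∈ W, endAction (limPoly P) A z ∈ W) :
    Set.range ((limFunctor n).map (subFunctorι P.obj W)) = (W : Set (LimSpace P.obj)) := by
  refine Set.Subset.antisymm (Set.range_subset_iff.2 fun z => ?_) fun z hz => ?_
  · obtain ⟨j, x, rfl⟩ := exists_limOf z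
    have x_mem : x.1 ∈ subVal P.obj W (stdFlag (cst n j)) := x.2
    rw [mem_subVal_cst hW] at x_mem
    exact Set.mem_of_eq_of_mem (limFunctor_map_limOf _ j x) x_mem
  · obtain ⟨j, x, rfl⟩ := exists_limOf (F := P.obj) z
    exact ⟨limOf (subFunctor P.obj W) j ⟨x, (mem_subVal_cst hW).2 hz⟩,
      limFunctor_map_limOf (subFunctorι P.obj W) j _⟩

theorem map_quotFunctorπ_eq_zero_iff
    (hW : ∀ A : flagEnd n, ∀ z ∈ W, endAction (limPoly P) A z ∈ W) (z : LimSpace P.obj) :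
    (limFunctor n).map (quotFunctorπ P.obj W) z = 0 ↔ z ∈ W := by
  obtain ⟨j, x, rfl⟩ := exists_limOf z
  exact (Eq.congr_left (limFunctor_map_limOf (quotFunctorπ P.obj W) j x)).trans
    ((map_eq_zero_iff _ (limOf_injective (quotFunctor P.obj W) j)).trans
      ((Submodule.Quotient.mk_eq_zero _).trans (mem_subVal_cst hW)))

theorem exists_lim_iso_of_mono {Z : Rep.{0} ℂ (G n)} (m : Z ⟶ (limFunctor n).obj P.obj) [Mono m] :
    ∃ P' : PolyFunctor n, Nonempty ((limFunctor n).obj P'.obj ≅ Z) := by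
  let Z' : PolyRep n := ⟨Z, isPolynomial_of_mono m (isPolyRep_lim P)⟩
  let m' : Z' ⟶ limPoly P := ObjectProperty.homMk m
  let W : Submodule ℂ (LimSpace P.obj) := LinearMap.range m.hom.toLinearMap
  have W_stable (A : flagEnd n) : ∀ z ∈ W, endAction (limPoly P) A z ∈ W := by
    rintro _ ⟨z, rfl⟩
    exact ⟨endAction Z' A z, endAction_natural m' A z⟩
  exact ⟨⟨subFunctor P.obj W, isPolynomial_of_mono (subFunctorι P.obj W) P.property⟩,
    nonempty_iso_of_range_eq ((limFunctor n).map (subFunctorι P.obj W)) m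
      (range_map_subFunctorι W_stable)⟩

theorem exists_lim_iso_of_epi {V : Rep.{0} ℂ (G n)} (q : (limFunctor n).obj P.obj ⟶ V) [Epi q] :
    ∃ P' : PolyFunctor n, Nonempty ((limFunctor n).obj P'.obj ≅ V) := by
  let V' : PolyRep n := ⟨V, isPolynomial_of_epi q (isPolyRep_lim P)⟩
  let q' : limPoly P ⟶ V' := ObjectProperty.homMk q
  let K : Submodule ℂ (LimSpace P.obj) := LinearMap.ker q.hom.toLinearMap
  have K_stable (A : flagEnd n) : ∀ z ∈ K, endAction (limPoly P) A z ∈ K := by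
    intro z (hz : q.hom z = 0)
    exact (endAction_natural q' A z).trans ((congrArg (endAction V' A) hz).trans (map_zero _))
  exact ⟨⟨quotFunctor P.obj K, isPolynomial_of_epi (quotFunctorπ P.obj K) P.property⟩,
    nonempty_iso_of_ker_eq ((limFunctor n).map (quotFunctorπ P.obj K)) q
      (map_quotFunctorπ_eq_zero_iff K_stable)⟩

instance (n : ℕ) : (Phi n isPolyRep_lim).EssSurj where
  mem_essImage V := by
    obtain ⟨k, a, Z, i, q, _, _⟩ := V.property
    let P : PolyFunctor n := ⟨_, isPolynomial_biproduct_tensorPow (flagForget n) a⟩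
    obtain ⟨P', ⟨e'⟩⟩ := exists_lim_iso_of_mono (P := P)
      (i ≫ (mapSumTensorPow (limFunctor n) (asIso (limForget n)) a).inv)
    obtain ⟨P'', ⟨e''⟩⟩ := exists_lim_iso_of_epi (P := P') (e'.hom ≫ q)
    exact ⟨P'', ⟨(isPolyRep n).isoMk e''⟩⟩

end EssentialImage

section Equivalence

variable {n : ℕ}

theorem exists_retract_stdIncFunctor (U : FlagCat n) :
    ∃ a, Nonempty (Retract U ((stdIncFunctor n).obj a)) :=
  let ⟨_, h⟩ := exists_retract U
  ⟨_, h⟩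

instance : (restrictStd n).Faithful := by
  have := whiskeringLeft_obj_faithful_of_retract (stdIncFunctor n) (FGModuleCat ℂ)
    exists_retract_stdIncFunctor
  unfold restrictStd
  infer_instance

instance : (restrictStd n).Full := by
  have := whiskeringLeft_obj_full_of_retract (stdIncFunctor n) (FGModuleCat ℂ)
    exists_retract_stdIncFunctor
  unfold restrictStd
  infer_instance

theorem exists_mem_invariants (V : PolyRep n) (x : V.obj) :
    ∃ j, x ∈ invariants V.obj (cst n j) := by
  let F := (Phi n isPolyRep_lim).objPreimage V
  let e : (Phi n isPolyRep_lim).obj F ≅ V := (Phi n isPolyRep_lim).objObjPreimageIso V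
  obtain ⟨j, y, hy⟩ := exists_limOf (F := F.obj) (e.inv.hom.hom x)
  have inv_mem : e.inv.hom.hom x ∈ invariants (limPoly F).obj (cst n j) := by
    rw [← hy, ← toLim_cst]
    exact toLim_mem_invariants F _ y
  refine ⟨j, ?_⟩
  rw [← show e.hom.hom.hom (e.inv.hom.hom x) = x from
    congrArg (fun f => f.hom.hom x) e.inv_hom_id]
  exact ((((invFunctor n).map e.hom).app (cst n j)).hom ⟨_, inv_mem⟩).2

instance : (invFunctor n).Faithful where
  map_injective {V W φ ψ} h := by
    refine ObjectProperty.hom_ext _ (ConcreteCategory.hom_ext _ _ fun x => ?_)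
    obtain ⟨j, hx⟩ := exists_mem_invariants V x
    exact congrArg Subtype.val (congrArg (fun η => (η.app (cst n j)).hom ⟨x, hx⟩) h)

instance : (Phi n isPolyRep_lim).Faithful :=
  Functor.Faithful.of_comp_iso (invIso n).symm

instance : (Phi n isPolyRep_lim).Full :=
  Functor.Full.of_comp_faithful_iso (invIso n).symm

instance : (Phi n isPolyRep_lim).IsEquivalence where

end Equivalence

section Comparison

variable {n : ℕ}

instance : (Phi n isPolyRep_lim).Braided :=
  liftBraided (isPolyRep n) ((isPolyFunctor n).ι ⋙ limFunctor n) isPolyRep_lim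

instance : (Phi n isPolyRep_lim).Additive where
  map_add {_ _ f g} :=
    (isPolyRep n).ι.map_injective ((limFunctor n).map_add (f := f.hom) (g := g.hom))

instance : (Phi n isPolyRep_lim).Linear ℂ where
  map_smul f c := (isPolyRep n).ι.map_injective ((limFunctor n).map_smul c f.hom)

theorem Phi_mu (F F' : PolyFunctor n) :
    (Functor.LaxMonoidal.μ (Phi n isPolyRep_lim) F F').hom =
      Functor.LaxMonoidal.μ (limFunctor n) F.obj F'.obj := by
  change Functor.LaxMonoidal.μ (limFunctor n) F.obj F'.obj ≫ (limFunctor n).map (𝟙 _) = _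
  rw [CategoryTheory.Functor.map_id, Category.comp_id]

theorem Phi_epsilon :
    (Functor.LaxMonoidal.ε (Phi n isPolyRep_lim)).hom =
      Functor.LaxMonoidal.ε (limFunctor n) := by
  change Functor.LaxMonoidal.ε (limFunctor n) ≫ (limFunctor n).map (𝟙 _) = _
  rw [CategoryTheory.Functor.map_id, Category.comp_id]

theorem Phi_delta (F F' : PolyFunctor n) :
    (Functor.OplaxMonoidal.δ (Phi n isPolyRep_lim) F F').hom = limDelta F.obj F'.obj := by
  change (limFunctor n).map (𝟙 _) ≫ limDelta F.obj F'.obj = _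
  rw [CategoryTheory.Functor.map_id, Category.id_comp]

theorem Phi_eta : (Functor.OplaxMonoidal.η (Phi n isPolyRep_lim)).hom = limEta n := by
  change (limFunctor n).map (𝟙 _) ≫ limEta n = _
  rw [CategoryTheory.Functor.map_id, Category.id_comp]

theorem limDeltaLin_toLim (F F' : FlagFunctor n) (a : Fin n → ℕ) (x : stdVal F a)
    (y : stdVal F' a) :
    limDeltaLin F F' (toLim (F ⊗ F') a (valTmul x y)) =
      TensorProduct.tmul ℂ (toLim F a x) (toLim F' a y) :=
  limDeltaLin_tmul (mapLin F (stdIncl (le_cst_sup a)) x) (mapLin F' (stdIncl (le_cst_sup a)) y)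

/-- The direct limit functor `Φ` as an equivalence of categories; its inverse is `Ψ`. -/
def phiEquiv (n : ℕ) : PolyFunctor n ≌ PolyRep n := (Phi n isPolyRep_lim).asEquivalence

instance : (phiEquiv n).functor.Braided := inferInstanceAs (Phi n isPolyRep_lim).Braided

instance : (phiEquiv n).functor.Additive := inferInstanceAs (Phi n isPolyRep_lim).Additive

instance : (phiEquiv n).functor.Linear ℂ := inferInstanceAs ((Phi n isPolyRep_lim).Linear ℂ)

instance : (phiEquiv n).inverse.Braided := inverseBraided (phiEquiv n)

/-- The adjunction `Φ ⊣ Ψ` underlying the equivalence `phiEquiv`. -/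
def phiAdj (n : ℕ) : Phi n isPolyRep_lim ⊣ (phiEquiv n).inverse := (phiEquiv n).toAdjunction

instance : (phiAdj n).IsMonoidal := toAdjunction_isMonoidal (phiEquiv n)

/-- The functor `Ψ` sends a polynomial representation `V` to `ℂ^a ↦ V^{H_a}`. -/
def psiIso (n : ℕ) : (phiEquiv n).inverse ⋙ restrictStd n ≅ invFunctor n :=
  Functor.isoWhiskerLeft (phiEquiv n).inverse (invIso n) ≪≫
    (Functor.associator _ _ _).symm ≪≫
    Functor.isoWhiskerRight (phiEquiv n).counitIso (invFunctor n) ≪≫ Functor.leftUnitor _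

theorem fromPsi_eq_counit_toLim (V : PolyRep n) (a : Fin n → ℕ)
    (x : stdVal ((phiEquiv n).inverse.obj V).obj a) :
    fromPsi (psiIso n) V a x =
      ((phiAdj n).counit.app V).hom.hom (toLim ((phiEquiv n).inverse.obj V).obj a x) :=
  rfl

theorem fromPsi_mu (V W : PolyRep n) (a : Fin n → ℕ)
    (x : stdVal ((phiEquiv n).inverse.obj V).obj a)
    (y : stdVal ((phiEquiv n).inverse.obj W).obj a) :
    fromPsi (psiIso n) (V ⊗ W) a
      (((Functor.LaxMonoidal.μ (phiEquiv n).inverse V W).hom.app (stdFlag a)).hom.hom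
        (TensorProduct.tmul ℂ x y)) =
      TensorProduct.tmul ℂ (fromPsi (psiIso n) V a x) (fromPsi (psiIso n) W a y) := by
  have counit_tensor := congrArg
    (fun f => f.hom.hom (toLim (((phiEquiv n).inverse.obj V).obj ⊗
      ((phiEquiv n).inverse.obj W).obj) a (valTmul x y)))
    (Adjunction.map_μ_comp_counit_app_tensor (phiAdj n) V W)
  refine (fromPsi_eq_counit_toLim _ _ _).trans ((congrArg _ (limMap_toLim
    (Functor.LaxMonoidal.μ (phiEquiv n).inverse V W).hom a (valTmul x y)).symm).trans
      (counit_tensor.trans ?_))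
  change TensorProduct.map ((phiAdj n).counit.app V).hom.hom.toLinearMap
    ((phiAdj n).counit.app W).hom.hom.toLinearMap
    ((Functor.OplaxMonoidal.δ (Phi n isPolyRep_lim) _ _).hom.hom _) = _
  rw [Phi_delta]
  exact (congrArg _ (limDeltaLin_toLim _ _ a x y)).trans (TensorProduct.map_tmul _ _ _ _)

theorem fromPsi_epsilon (a : Fin n → ℕ) :
    fromPsi (psiIso n) (𝟙_ (PolyRep n)) a
      (((Functor.LaxMonoidal.ε (phiEquiv n).inverse).hom.app (stdFlag a)).hom.hom (1 : ℂ)) =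
      (1 : ℂ) := by
  have counit_unit := congrArg (fun f => f.hom.hom (toLim (𝟙_ (FlagFunctor n)) a (1 : ℂ)))
    (Adjunction.map_ε_comp_counit_app_unit (phiAdj n))
  refine (fromPsi_eq_counit_toLim _ _ _).trans ((congrArg _ (limMap_toLim
    (Functor.LaxMonoidal.ε (phiEquiv n).inverse).hom a (1 : ℂ)).symm).trans
      (counit_unit.trans ?_))
  change (Functor.OplaxMonoidal.η (Phi n isPolyRep_lim)).hom.hom _ = _
  rw [Phi_eta]
  exact limEtaLin_limOf _ 1

end Comparison

end

end FlagSchur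

theorem mainTheorem3 (n : ℕ) (hn : 1 ≤ n) :
    ∃ (h : ∀ F : PolyFunctor n, isPolyRep n ((limFunctor n).obj F.obj))
      (Ψ : PolyRep n ⥤ PolyFunctor n) (θ : Ψ ⋙ restrictStd n ≅ invFunctor n)
      (_ : (Phi n h).Braided) (_ : Ψ.Braided) (adj : Phi n h ⊣ Ψ),
      ((Phi n h).Additive ∧ (Phi n h).Linear ℂ) ∧ (Ψ.Additive ∧ Ψ.Linear ℂ) ∧
      adj.IsMonoidal ∧ (∀ F, IsIso (adj.unit.app F)) ∧ (∀ V, IsIso (adj.counit.app V)) ∧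
      (∀ (V : PolyRep n) (j : ℕ) (x : ((Ψ.obj V).obj.obj (stdFlag (cst n j))).obj),
        (adj.counit.app V).hom.hom (toPhi h (Ψ.obj V) j x) = fromPsi θ V (cst n j) x) ∧
      (∀ (F F' : PolyFunctor n) (j : ℕ) (x : (F.obj.obj (stdFlag (cst n j))).obj)
        (y : (F'.obj.obj (stdFlag (cst n j))).obj),
        (Functor.LaxMonoidal.μ (Phi n h) F F').hom.hom
            (TensorProduct.tmul ℂ (toPhi h F j x) (toPhi h F' j y)) =
          toPhi h (F ⊗ F') j (TensorProduct.tmul ℂ x y)) ∧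
      (∀ j : ℕ, (Functor.LaxMonoidal.ε (Phi n h)).hom.hom (1 : ℂ) = toPhi h (𝟙_ (PolyFunctor n)) j (1 : ℂ)) ∧
      (∀ (V W : PolyRep n) (a : Fin n → ℕ) (x : ((Ψ.obj V).obj.obj (stdFlag a)).obj)
        (y : ((Ψ.obj W).obj.obj (stdFlag a)).obj),
        fromPsi θ (V ⊗ W) a (((Functor.LaxMonoidal.μ Ψ V W).hom.app (stdFlag a)).hom.hom
            (TensorProduct.tmul ℂ x y)) =
          TensorProduct.tmul ℂ (fromPsi θ V a x) (fromPsi θ W a y)) ∧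
      (∀ a : Fin n → ℕ,
        fromPsi θ (𝟙_ (PolyRep n)) a (((Functor.LaxMonoidal.ε Ψ).hom.app (stdFlag a)).hom.hom (1 : ℂ)) = (1 : ℂ)) := by
  refine ⟨isPolyRep_lim, (phiEquiv n).inverse, psiIso n, inferInstance, inferInstance, phiAdj n,
    ⟨inferInstance, inferInstance⟩, ⟨inferInstance, inferInstance⟩, inferInstance,
    fun F => inferInstanceAs (IsIso ((phiEquiv n).unitIso.hom.app F)),
    fun V => inferInstanceAs (IsIso ((phiEquiv n).counitIso.hom.app V)),
    fun V j x => ?_, fun F F' j x y => ?_, fun j => ?_, fromPsi_mu, fromPsi_epsilon⟩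
  · rw [fromPsi_eq_counit_toLim, toLim_cst]
    rfl
  · rw [Phi_mu]
    exact lim_mu_tmul x y
  · rw [Phi_epsilon]
    exact lim_epsilon_one j
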